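/- Let $(X_j,Y_j,S_j)_{j\in\mathbb Z}$ be a strictly stationary process on a probability space, where $X_j\in\{0,1\}$ and $Y_j\in\mathcal Y$, $S_j\in\mathcal S$ with $\mathcal Y,\mathcal S$ finite. It is called a finite-state aperiodic irreducible Markov (FAIM) process if, for every $j$, conditioned on $S_{j-1}$ the family $(X_k,Y_k,S_k)_{k\ge j}$ is independent of the family $(X_l,Y_l,S_{l-1})_{l<j}$, and the stationary homogeneous Markov chain $(S_j)$ is irreducible and aperiodic. For $n\ge 0$ and $N=2^n$ let $G_N=B_N\begin{bmatrix}1&0\\1&1\end{bmatrix}^{\otimes n}$, where $B_N$ is the $N\times N$ bit-reversal permutation matrix. Put $U_1^N=X_1^N G_N$ (arithmetic modulo $2$) and $Q_i=(U_1^{i-1},Y_1^N)$ for $1\le i\le N$. The boundary-state-informed (BSI) Bhattacharyya parameter is $$Z(U_i\mid Q_i,S_N,S_0)=\sum_{a,b\in\mathcal S}\mathbb P(S_0=a,S_N=b)\cdot 2\sum_q\sqrt{P_a^b(0,q)\,P_a^b(1,q)},$$ where $P_a^b(u,q)=\mathbb P(U_i=u,Q_i=q\mid S_0=a,S_N=b)$,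 and pairs $(a,b)$ of probability zero contribute $0$. Let $B_1,B_2,\dots$ be i.i.d. Bernoulli-$1/2$ random variables. The BSI Bhattacharyya process is the sequence of random variables $\hat Z_n=Z(U_i\mid Q_i,S_N,S_0)$ with $i-1=(B_1B_2\cdots B_n)_2=\sum_{j=1}^n B_j2^{n-j}$. A sequence $A_n$ of $[0,1]$-valued random variables polarizes if it converges almost surely to a $\{0,1\}$-valued random variable $A_\infty$. It polarizes fast to $0$ with $\beta>0$ if it polarizes and $\lim_{n\to\infty}\mathbb P(A_n<2^{-2^{n\beta}})=\mathbb P(A_\infty=0)$. It polarizes fast to $1$ with $\beta>0$ if it polarizes and $\lim_{n\to\infty}\mathbb P(A_n>1-2^{-2^{n\beta}})=\mathbb P(A_\infty=1)$. **Corollary.** For every FAIM process and every $0<\beta<1/2$, the BSI Bhattacharyya process $\hat Z_n$ polarizes fast to $0$ with $\beta$ and polarizes fast to $1$ with $\beta$. -/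

import Mathlib

open MeasureTheory ProbabilityTheory Filter Topology
open scoped Kronecker

namespace Polar

/-! ### Finite-state aperiodic irreducible Markov (FAIM) processes -/

/-- The `n`-step transition probability `ℙ(S_n = b | S_0 = a)` of a stationary state sequence
(with value `0` if `ℙ(S_0 = a) = 0`). -/
noncomputable def stepProb {Ω 𝒮 : Type*} [MeasurableSpace Ω] (μ : Measure Ω) (S : ℤ → Ω → 𝒮)
    (n : ℕ) (a b : 𝒮) : ℝ :=
  (μ[|S 0 ⁻¹' {a}]).real (S n ⁻¹' {b})

/-- `(X_j, Y_j, S_j)`, `j ∈ ℤ`, is a FAIM process: it is strictly stationary, conditioned on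
`S_{j-1}` the family `(X_k, Y_k, S_k)`, `k ≥ j`, is independent of the family
`(X_l, Y_l, S_{l-1})`, `l < j`, and the (finite-state, stationary, homogeneous) Markov chain `S_j`
is irreducible and aperiodic. -/
structure IsFAIM {Ω 𝒴 𝒮 : Type*} [MeasurableSpace Ω] [MeasurableSpace 𝒴] [MeasurableSpace 𝒮]
    (μ : Measure Ω) (X : ℤ → Ω → ZMod 2) (Y : ℤ → Ω → 𝒴) (S : ℤ → Ω → 𝒮) : Prop where
  measurable_X : ∀ j, Measurable (X j)
  measurable_Y : ∀ j, Measurable (Y j)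
  measurable_S : ∀ j, Measurable (S j)
  stationary : ∀ k : ℤ, IdentDistrib
    (fun ω (j : ℤ) => (X (j + k) ω, Y (j + k) ω, S (j + k) ω))
    (fun ω (j : ℤ) => (X j ω, Y j ω, S j ω)) μ μ
  /- Conditioning on a value `s` of probability zero gives the zero measure, for which the
  independence holds trivially. -/
  markov : ∀ (j : ℤ) (s : 𝒮), IndepFun
    (fun ω (l : Set.Iio j) => (X l ω, Y l ω, S (l - 1) ω))
    (fun ω (k : Set.Ici j) => (X k ω, Y k ω, S k ω))
    (μ[|S (j - 1) ⁻¹' {s}])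
  irreducible : ∀ a b : 𝒮, ∃ n : ℕ, 0 < n ∧ 0 < stepProb μ S n a b
  /- The greatest common divisor of the possible return times to any state is one. -/
  aperiodic : ∀ (a : 𝒮) (d : ℕ),
    (∀ n : ℕ, 0 < n → 0 < stepProb μ S n a a → d ∣ n) → d = 1

/-! ### The polarization transform -/

/-- The kernel `G₂ = [1 0; 1 1]` over the field with two elements. -/
def kernel : Matrix (Fin 2) (Fin 2) (ZMod 2) := !![1, 0; 1, 1]

/-- The Kronecker power `G₂^{⊗ n}`, rows and columns indexed by `0, …, 2^n - 1`. -/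
def kernelPow : (n : ℕ) → Matrix (Fin (2 ^ n)) (Fin (2 ^ n)) (ZMod 2)
  | 0 => 1
  | n + 1 =>
    let e : Fin 2 × Fin (2 ^ n) ≃ Fin (2 ^ (n + 1)) :=
      finProdFinEquiv.trans (finCongr (pow_succ' 2 n).symm)
    (kernel ⊗ₖ kernelPow n).reindex e e

/-- The `2^n × 2^n` bit-reversal permutation matrix. -/
def bitReversal (n : ℕ) : Matrix (Fin (2 ^ n)) (Fin (2 ^ n)) (ZMod 2) :=
  Matrix.of fun i j =>
    if ∀ k < n, (j : ℕ).testBit k = (i : ℕ).testBit (n - 1 - k) then 1 else 0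

/-- Arıkan's polarization matrix `G_N = B_N G₂^{⊗ n}`, `N = 2^n`. -/
def polarMatrix (n : ℕ) : Matrix (Fin (2 ^ n)) (Fin (2 ^ n)) (ZMod 2) :=
  bitReversal n * kernelPow n

/-- The row vector `U_1^N = X_1^N G_N`, `N = 2^n`; the entry with index `i : Fin (2 ^ n)`
is `U_{i+1}`. -/
def U {Ω : Type*} (X : ℤ → Ω → ZMod 2) (n : ℕ) (i : Fin (2 ^ n)) (ω : Ω) : ZMod 2 :=
  Matrix.vecMul (fun j : Fin (2 ^ n) => X (((j : ℕ) : ℤ) + 1) ω) (polarMatrix n) i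

/-- The observation attached to `U_{i+1}`: the pair `(U_1^i, Y_1^N)`, `N = 2^n`. -/
def Q {Ω 𝒴 : Type*} (X : ℤ → Ω → ZMod 2) (Y : ℤ → Ω → 𝒴) (n : ℕ) (i : Fin (2 ^ n)) (ω : Ω) :
    (Fin (i : ℕ) → ZMod 2) × (Fin (2 ^ n) → 𝒴) :=
  (fun k => U X n (Fin.castLE i.is_lt.le k) ω, fun j => Y (((j : ℕ) : ℤ) + 1) ω)

/-! ### The boundary-state-informed Bhattacharyya process -/

/-- The Bhattacharyya parameter `Z(U|Q) = 2 ∑_q √(P(U = 0, Q = q) P(U = 1, Q = q))`. -/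
noncomputable def bhattacharyya {Ω 𝒬 : Type*} [MeasurableSpace Ω] [Fintype 𝒬] (μ : Measure Ω)
    (U : Ω → ZMod 2) (Q : Ω → 𝒬) : ℝ :=
  2 * ∑ q, √(μ.real {ω | U ω = 0 ∧ Q ω = q} * μ.real {ω | U ω = 1 ∧ Q ω = q})

/-- The boundary-state-informed Bhattacharyya parameter: the average over the values `a`, `b` of the
boundary states `S₀`, `S_N` of the Bhattacharyya parameter of the conditional law of `(U, Q)`
given `S₀ = a`, `S_N = b`. -/
noncomputable def bhattacharyyaBSI {Ω 𝒬 𝒮 : Type*} [MeasurableSpace Ω] [Fintype 𝒬] [Fintype 𝒮]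
    (μ : Measure Ω) (U : Ω → ZMod 2) (Q : Ω → 𝒬) (S₀ S_N : Ω → 𝒮) : ℝ :=
  ∑ a, ∑ b, μ.real {ω | S₀ ω = a ∧ S_N ω = b} *
    bhattacharyya (μ[|{ω | S₀ ω = a ∧ S_N ω = b}]) U Q

lemma sum_bits_lt (b : ℕ → Bool) (n : ℕ) :
    ∑ j ∈ Finset.range n, (b j).toNat * 2 ^ (n - 1 - j) < 2 ^ n := by
  induction n with
  | zero => simp
  | succ n ih =>
    have h : ∑ j ∈ Finset.range n, (b j).toNat * 2 ^ (n + 1 - 1 - j)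
        = 2 * ∑ j ∈ Finset.range n, (b j).toNat * 2 ^ (n - 1 - j) := by
      rw [Finset.mul_sum]
      refine Finset.sum_congr rfl fun j hj => ?_
      have hj' := Finset.mem_range.1 hj
      rw [show n + 1 - 1 - j = (n - 1 - j) + 1 by omega, pow_succ]
      ring
    rw [Finset.sum_range_succ, h, pow_succ]
    have hb : (b n).toNat ≤ 1 := Bool.toNat_le _
    simp only [Nat.add_sub_cancel, Nat.sub_self, pow_zero, mul_one]
    omega

/-- The number `(b_0 b_1 ⋯ b_{n-1})_2 ∈ {0, …, 2^n - 1}`, with `b_0` the most significant bit. -/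
def binaryIndex (b : ℕ → Bool) (n : ℕ) : Fin (2 ^ n) :=
  ⟨∑ j ∈ Finset.range n, (b j).toNat * 2 ^ (n - 1 - j), sum_bits_lt b n⟩

/-- The boundary-state-informed Bhattacharyya process `Ẑ_n`, as a random variable of the selecting
bits `B`, where `B j` stands for `B_{j+1}`. -/
noncomputable def ZHat {Ω Ω' 𝒴 𝒮 : Type*} [MeasurableSpace Ω] [Fintype 𝒴] [Fintype 𝒮]
    (μ : Measure Ω) (X : ℤ → Ω → ZMod 2) (Y : ℤ → Ω → 𝒴) (S : ℤ → Ω → 𝒮) (B : ℕ → Ω' → Bool)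
    (n : ℕ) (ω' : Ω') : ℝ :=
  let i := binaryIndex (fun j => B j ω') n
  bhattacharyyaBSI μ (U X n i) (Q X Y n i) (S 0) (S (2 ^ n))

/-! ### Polarization -/

/-- `A_n`, a sequence of `[0,1]`-valued random variables, polarizes to the `{0,1}`-random
variable `A_∞`. -/
structure PolarizesTo {Ω' : Type*} [MeasurableSpace Ω'] (P : Measure Ω') (A : ℕ → Ω' → ℝ)
    (A_inf : Ω' → ℝ) : Prop where
  measurable : ∀ n, Measurable (A n)
  mem_Icc : ∀ n ω, A n ω ∈ Set.Icc (0 : ℝ) 1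
  measurable_inf : Measurable A_inf
  inf_eq : ∀ ω, A_inf ω = 0 ∨ A_inf ω = 1
  tendsto : ∀ᵐ ω ∂P, Tendsto (fun n => A n ω) atTop (𝓝 (A_inf ω))

/-- `A_n` polarizes fast to `0` with `β`. -/
def PolarizesFastToZero {Ω' : Type*} [MeasurableSpace Ω'] (P : Measure Ω') (A : ℕ → Ω' → ℝ)
    (β : ℝ) : Prop :=
  ∃ A_inf : Ω' → ℝ, PolarizesTo P A A_inf ∧
    Tendsto (fun n : ℕ => P.real {ω | A n ω < (2 : ℝ) ^ (-(2 : ℝ) ^ ((n : ℝ) * β))}) atTop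
      (𝓝 (P.real {ω | A_inf ω = 0}))

/-- `A_n` polarizes fast to `1` with `β`. -/
def PolarizesFastToOne {Ω' : Type*} [MeasurableSpace Ω'] (P : Measure Ω') (A : ℕ → Ω' → ℝ)
    (β : ℝ) : Prop :=
  ∃ A_inf : Ω' → ℝ, PolarizesTo P A A_inf ∧
    Tendsto (fun n : ℕ => P.real {ω | A n ω > 1 - (2 : ℝ) ^ (-(2 : ℝ) ^ ((n : ℝ) * β))}) atTop
      (𝓝 (P.real {ω | A_inf ω = 1}))

end Polar

/-!
Polarization of a stationary process that is driven by a finite-state Markov chain.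

Two adjacent blocks of the process are independent given the state between them
(`IsFAIM.measureReal_twoBlocks`), and one polarization step replaces the bit `U` of a block by the
sum `U + V` of the bits of two adjacent blocks (minus) and by `V` (plus). Three quantities are
followed through the polarization tree, each a sum over the observations of a weight of the two
masses of the bit: the entropy `H`, the Bhattacharyya parameter `Z` and the total variation `K`.

*Convergence.* The entropy conditioned on the boundary states is a bounded submartingale along the
random path, because hiding the middle state can only increase entropy (`entropy_step_ge`); hence it
converges almost surely. Irreducibility and aperiodicity give a positive lower bound on the mass of
every pair of boundary states of long blocks (`exists_le_statePair`), and then a minus step raises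
the entropy by a definite amount unless the entropy is close to `0` or `log 2`
(`entropy_minus_gap`). So the limit is `0` or `log 2` (`ae_tendsto_path`).

*The entropy without boundary states.* By the chain rule, the sums over a whole level of the
entropies with and without the boundary states differ by at most the logarithm of the number of
pairs of states (`sum_entropy_sub_le`). The mean difference at level `n` is therefore of order
`2 ^ (-n)`, and both entropies have the same limit on almost every path.

*Speed.* Without the boundary states, `Z` is at most multiplied by a constant in a minus step, and
at most squared up to a constant in a plus step, since adjacent blocks are dominated by independent
copies. With the boundary states, `K` obeys the same recursion with the steps exchanged. Along a
path on which such a quantity tends to zero and on which half of the steps are squaring steps, it is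
eventually below `2 ^ (-2 ^ (n β))` for each `β < 1 / 2` (`eventually_lt_of_squaring`). The boundary
states only decrease `Z`, and `1 - Z ≤ K`; hence the two kinds of fast polarization.
-/

namespace Polar

/-! ### Pairs of masses -/

/-- The unnormalised binary entropy (in nats) of a pair of masses:
`(x + y) h(x / (x + y))`, where `h` is the binary entropy function. -/
noncomputable def pairEntropy (x y : ℝ) : ℝ :=
  Real.negMulLog x + Real.negMulLog y - Real.negMulLog (x + y)

/-- The Bhattacharyya weight of a pair of masses. -/
noncomputable def pairBhat (x y : ℝ) : ℝ := 2 * √(x * y)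

/-- The total variation weight of a pair of masses. -/
noncomputable def pairDist (x y : ℝ) : ℝ := |x - y|

/-- The normalised squared Bhattacharyya weight `(x + y) (2√(xy) / (x + y))²`. -/
noncomputable def pairSqBhat (x y : ℝ) : ℝ := 4 * (x * y) / (x + y)

/-- The normalised squared total variation weight `(x + y) (|x - y| / (x + y))²`. -/
noncomputable def pairSqDist (x y : ℝ) : ℝ := (x - y) ^ 2 / (x + y)

lemma pairSqBhat_nonneg {x y : ℝ} (hx : 0 ≤ x) (hy : 0 ≤ y) : 0 ≤ pairSqBhat x y := by
  unfold pairSqBhat; positivity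

lemma pairSqDist_nonneg {x y : ℝ} (hx : 0 ≤ x) (hy : 0 ≤ y) : 0 ≤ pairSqDist x y := by
  unfold pairSqDist; positivity

lemma pairSqBhat_add_pairSqDist {x y : ℝ} (hx : 0 ≤ x) (hy : 0 ≤ y) :
    pairSqBhat x y + pairSqDist x y = x + y := by
  unfold pairSqBhat pairSqDist
  rcases (add_nonneg hx hy).eq_or_lt with h | h
  · rw [← h]; simp
  · field_simp; ring

lemma pairBhat_smul {c : ℝ} (hc : 0 ≤ c) (x y : ℝ) :
    pairBhat (c * x) (c * y) = c * pairBhat x y := by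
  unfold pairBhat
  rw [show c * x * (c * y) = c ^ 2 * (x * y) by ring, Real.sqrt_mul (sq_nonneg c),
    Real.sqrt_sq hc]
  ring

lemma pairEntropy_smul (c x y : ℝ) : pairEntropy (c * x) (c * y) = c * pairEntropy x y := by
  unfold pairEntropy
  rw [← mul_add, Real.negMulLog_mul, Real.negMulLog_mul, Real.negMulLog_mul]
  ring

lemma pairEntropy_eq_mul_binEntropy {x y : ℝ} (h : x + y ≠ 0) :
    pairEntropy x y = (x + y) * Real.binEntropy (x / (x + y)) := by
  have h1 : 1 - x / (x + y) = y / (x + y) := by field_simp; ring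
  rw [Real.binEntropy_eq_negMulLog_add_negMulLog_one_sub, h1]
  have := pairEntropy_smul (x + y) (x / (x + y)) (y / (x + y))
  rw [mul_div_cancel₀ _ h, mul_div_cancel₀ _ h] at this
  rw [this]
  unfold pairEntropy
  rw [← add_div, div_self h]
  simp

/-- Concavity of the binary entropy function, in homogeneous form. -/
lemma pairEntropy_add_le {x y x' y' : ℝ} (hx : 0 ≤ x) (hy : 0 ≤ y) (hx' : 0 ≤ x') (hy' : 0 ≤ y') :
    pairEntropy x y + pairEntropy x' y' ≤ pairEntropy (x + x') (y + y') := by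
  rcases (add_nonneg hx hy).eq_or_lt with h | h
  · have h1 : x = 0 := by linarith
    have h2 : y = 0 := by linarith
    subst h1 h2; simp [pairEntropy]
  rcases (add_nonneg hx' hy').eq_or_lt with h' | h'
  · have h1 : x' = 0 := by linarith
    have h2 : y' = 0 := by linarith
    subst h1 h2; simp [pairEntropy]
  have hs : 0 < (x + x') + (y + y') := by linarith
  rw [pairEntropy_eq_mul_binEntropy h.ne', pairEntropy_eq_mul_binEntropy h'.ne',
    pairEntropy_eq_mul_binEntropy hs.ne']
  have hm : ∀ {u v : ℝ}, 0 ≤ u → 0 ≤ v → 0 < u + v → u / (u + v) ∈ Set.Icc (0 : ℝ) 1 :=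
    fun hu hv huv => ⟨by positivity, (div_le_one huv).2 (by linarith)⟩
  have := Real.strictConcave_binEntropy.concaveOn.2 (hm hx hy h) (hm hx' hy' h')
    (div_nonneg h.le hs.le) (div_nonneg h'.le hs.le) (by field_simp; ring)
  simp only [smul_eq_mul] at this
  rw [show (x + y) / ((x + x') + (y + y')) * (x / (x + y)) +
    (x' + y') / ((x + x') + (y + y')) * (x' / (x' + y')) = (x + x') / ((x + x') + (y + y')) by
      field_simp] at this
  have h2 := mul_le_mul_of_nonneg_left this hs.le
  refine le_trans (le_of_eq ?_) h2
  field_simp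

lemma pairEntropy_sum_le {ι : Type*} (s : Finset ι) {f g : ι → ℝ} (hf : ∀ i, 0 ≤ f i)
    (hg : ∀ i, 0 ≤ g i) :
    ∑ i ∈ s, pairEntropy (f i) (g i) ≤ pairEntropy (∑ i ∈ s, f i) (∑ i ∈ s, g i) := by
  classical
  induction s using Finset.induction_on with
  | empty => simp [pairEntropy]
  | insert a s ha ih =>
    rw [Finset.sum_insert ha, Finset.sum_insert ha, Finset.sum_insert ha]
    exact (add_le_add_right ih _).trans (pairEntropy_add_le (hf a) (hg a)
      (Finset.sum_nonneg fun i _ => hf i) (Finset.sum_nonneg fun i _ => hg i))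

lemma pairBhat_sum_le {ι : Type*} (s : Finset ι) {f g : ι → ℝ} (hf : ∀ i, 0 ≤ f i)
    (hg : ∀ i, 0 ≤ g i) :
    ∑ i ∈ s, pairBhat (f i) (g i) ≤ pairBhat (∑ i ∈ s, f i) (∑ i ∈ s, g i) := by
  unfold pairBhat
  rw [← Finset.mul_sum, Real.sqrt_mul (Finset.sum_nonneg fun i _ => hf i)]
  simp_rw [Real.sqrt_mul (hf _)]
  gcongr
  exact Real.sum_sqrt_mul_sqrt_le s hf hg

/-- The chain rule for one polarization step on two independent pairs of masses: the entropies of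
the modulo-`2` sum, and of the second bit given the sum, add up to the entropies of the pairs. -/
lemma pairEntropy_chain (a₀ a₁ b₀ b₁ : ℝ) :
    pairEntropy (a₀ * b₀ + a₁ * b₁) (a₀ * b₁ + a₁ * b₀) + pairEntropy (a₀ * b₀) (a₁ * b₁) +
      pairEntropy (a₁ * b₀) (a₀ * b₁) =
    (b₀ + b₁) * pairEntropy a₀ a₁ + (a₀ + a₁) * pairEntropy b₀ b₁ := by
  unfold pairEntropy
  rw [show a₀ * b₀ + a₁ * b₁ + (a₀ * b₁ + a₁ * b₀) = (a₀ + a₁) * (b₀ + b₁) by ring,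
    show a₁ * b₀ + a₀ * b₁ = a₀ * b₁ + a₁ * b₀ by ring]
  simp only [Real.negMulLog_mul]
  ring

/-- The second derivative of the binary entropy is at most `-4`, so the binary entropy still
increases up to `1/2` after adding a quadratic that vanishes at `1/2`. -/
lemma binEntropy_add_sq_le {x y : ℝ} (hx : 0 ≤ x) (hxy : x ≤ y) (hy : y ≤ 1 / 2) :
    Real.binEntropy x + (1 - 2 * x) ^ 2 / 2 ≤ Real.binEntropy y + (1 - 2 * y) ^ 2 / 2 := by
  have hmono : MonotoneOn (fun t : ℝ => Real.binEntropy t + (1 - 2 * t) ^ 2 / 2)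
      (Set.Icc 0 (1 / 2)) := by
    refine monotoneOn_of_deriv_nonneg (convex_Icc _ _) ?_ ?_ ?_
    · exact (Real.binEntropy_continuous.add (by fun_prop)).continuousOn
    · intro t ht
      rw [interior_Icc] at ht
      exact ((Real.hasDerivAt_binEntropy ht.1.ne' (by linarith [ht.2])).differentiableAt.add
        (by fun_prop)).differentiableWithinAt
    · intro t ht
      rw [interior_Icc] at ht
      have h0 : 0 < t := ht.1
      have h1 : t < 1 / 2 := ht.2
      have hd : HasDerivAt (fun t : ℝ => Real.binEntropy t + (1 - 2 * t) ^ 2 / 2)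
          (Real.log (1 - t) - Real.log t + (2 * (1 - 2 * t) * (-2)) / 2) t := by
        refine (Real.hasDerivAt_binEntropy h0.ne' (by linarith)).add (HasDerivAt.div_const ?_ 2)
        have : HasDerivAt (fun t : ℝ => 1 - 2 * t) (-2) t := by
          simpa using ((hasDerivAt_id t).const_mul 2).const_sub 1
        simpa using this.fun_pow 2
      rw [hd.deriv, ← Real.log_div (by linarith) h0.ne']
      have := Real.le_log_one_add_of_nonneg (x := (1 - t) / t - 1)
        (by rw [sub_nonneg, le_div_iff₀ h0]; linarith)
      rw [add_sub_cancel] at this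
      have h2 : 2 * ((1 - t) / t - 1) / ((1 - t) / t - 1 + 2) = 2 * (1 - 2 * t) := by
        have : (1 - t) / t - 1 + 2 = 1 / t := by field_simp; ring
        rw [this]; field_simp; ring
      linarith
  exact hmono ⟨hx, hxy.trans hy⟩ ⟨hx.trans hxy, hy⟩ hxy

lemma binEntropy_add_sq_le' {x y : ℝ} (hx : 0 ≤ x) (hxy : x ≤ y) (hy : y ≤ 1 - x) :
    Real.binEntropy x + (1 - 2 * x) ^ 2 / 2 ≤ Real.binEntropy y + (1 - 2 * y) ^ 2 / 2 := by
  rcases le_total y (1 / 2) with h | h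
  · exact binEntropy_add_sq_le hx hxy h
  · have := binEntropy_add_sq_le hx (y := 1 - y) (by linarith) (by linarith)
    rw [Real.binEntropy_one_sub] at this
    linarith [show (1 - 2 * (1 - y)) ^ 2 = (1 - 2 * y) ^ 2 by ring]

/-- Convolving with an independent bit raises the binary entropy, by an amount that is bounded
below unless the added bit is nearly deterministic or the first one is nearly uniform. -/
lemma binEntropy_conv {x y : ℝ} (hx : x ∈ Set.Icc (0 : ℝ) 1) (hy : y ∈ Set.Icc (0 : ℝ) 1) :
    Real.binEntropy y + (1 / 2) * (4 * (x * (1 - x))) * (1 - 2 * y) ^ 2 ≤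
      Real.binEntropy (x * y + (1 - x) * (1 - y)) := by
  have key : ∀ y : ℝ, 0 ≤ y → y ≤ 1 / 2 →
      Real.binEntropy y + (1 / 2) * (4 * (x * (1 - x))) * (1 - 2 * y) ^ 2 ≤
      Real.binEntropy (x * y + (1 - x) * (1 - y)) := by
    intro y h0 h1
    have := binEntropy_add_sq_le' h0 (y := x * y + (1 - x) * (1 - y))
      (by nlinarith [hx.1, hx.2]) (by nlinarith [hx.1, hx.2])
    nlinarith [this]
  rcases le_total y (1 / 2) with h | h
  · exact key y hy.1 h
  · have := key (1 - y) (by linarith [hy.2]) (by linarith)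
    rw [Real.binEntropy_one_sub, ← Real.binEntropy_one_sub (x * (1 - y) + _)] at this
    convert this using 2 <;> ring

/-- The sum of two independent bits has more entropy than the second one, by an amount that is a
product of a contribution of each bit, which makes it summable over independent observations. -/
lemma pairEntropy_conv {a₀ a₁ b₀ b₁ : ℝ} (ha₀ : 0 ≤ a₀) (ha₁ : 0 ≤ a₁) (hb₀ : 0 ≤ b₀)
    (hb₁ : 0 ≤ b₁) :
    (a₀ + a₁) * pairEntropy b₀ b₁ + 1 / 2 * pairSqBhat a₀ a₁ * pairSqDist b₀ b₁ ≤
      pairEntropy (a₀ * b₀ + a₁ * b₁) (a₀ * b₁ + a₁ * b₀) := by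
  rcases (add_nonneg ha₀ ha₁).eq_or_lt with h | h
  · have h1 : a₀ = 0 := by linarith
    have h2 : a₁ = 0 := by linarith
    subst h1 h2; simp [pairEntropy, pairSqBhat]
  rcases (add_nonneg hb₀ hb₁).eq_or_lt with h' | h'
  · have h1 : b₀ = 0 := by linarith
    have h2 : b₁ = 0 := by linarith
    subst h1 h2; simp [pairEntropy, pairSqDist]
  have hs : a₀ * b₀ + a₁ * b₁ + (a₀ * b₁ + a₁ * b₀) = (a₀ + a₁) * (b₀ + b₁) := by ring
  have hpos := mul_pos h h'
  rw [pairEntropy_eq_mul_binEntropy h'.ne', pairEntropy_eq_mul_binEntropy (by rw [hs]; positivity),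
    hs]
  have := binEntropy_conv (x := a₀ / (a₀ + a₁)) (y := b₀ / (b₀ + b₁))
    ⟨by positivity, (div_le_one h).2 (by linarith)⟩ ⟨by positivity, (div_le_one h').2 (by linarith)⟩
  rw [show a₀ / (a₀ + a₁) * (b₀ / (b₀ + b₁)) + (1 - a₀ / (a₀ + a₁)) * (1 - b₀ / (b₀ + b₁)) =
    (a₀ * b₀ + a₁ * b₁) / ((a₀ + a₁) * (b₀ + b₁)) by field_simp; ring] at this
  refine le_trans (le_of_eq ?_) (mul_le_mul_of_nonneg_left this hpos.le)
  unfold pairSqBhat pairSqDist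
  field_simp
  ring

lemma pairSqDist_le_entropy {x y : ℝ} (hx : 0 ≤ x) (hy : 0 ≤ y) :
    pairSqDist x y ≤ 2 * ((x + y) * Real.log 2 - pairEntropy x y) := by
  rcases (add_nonneg hx hy).eq_or_lt with h | h
  · have h1 : x = 0 := by linarith
    have h2 : y = 0 := by linarith
    subst h1 h2; simp [pairEntropy, pairSqDist]
  have key : ∀ t : ℝ, 0 ≤ t → t ≤ 1 → Real.binEntropy t + (1 - 2 * t) ^ 2 / 2 ≤ Real.log 2 := by
    intro t h0 h1
    have h2 : ∀ t : ℝ, 0 ≤ t → t ≤ 1 / 2 →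
        Real.binEntropy t + (1 - 2 * t) ^ 2 / 2 ≤ Real.log 2 := fun t h0 h1 => by
      have := binEntropy_add_sq_le h0 h1 le_rfl
      rw [one_div, Real.binEntropy_two_inv] at this
      norm_num at this ⊢
      linarith
    rcases le_total t (1 / 2) with h | h
    · exact h2 t h0 h
    · have := h2 (1 - t) (by linarith) (by linarith)
      rw [Real.binEntropy_one_sub] at this
      linarith [show (1 - 2 * (1 - t)) ^ 2 = (1 - 2 * t) ^ 2 by ring]
  have := mul_le_mul_of_nonneg_left (key (x / (x + y)) (by positivity)
    ((div_le_one h).2 (by linarith))) h.le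
  rw [mul_add, ← pairEntropy_eq_mul_binEntropy h.ne'] at this
  have h3 : (x + y) * ((1 - 2 * (x / (x + y))) ^ 2 / 2) = pairSqDist x y / 2 := by
    unfold pairSqDist; field_simp; ring
  linarith

lemma pairEntropy_eq_log {x y : ℝ} (hx : 0 < x) (hy : 0 < y) :
    pairEntropy x y = x * Real.log ((x + y) / x) + y * Real.log ((x + y) / y) := by
  have h : 0 < x + y := by linarith
  rw [Real.log_div h.ne' hx.ne', Real.log_div h.ne' hy.ne']
  simp only [pairEntropy, Real.negMulLog]
  ring

lemma pairSqBhat_le_entropy {x y : ℝ} (hx : 0 ≤ x) (hy : 0 ≤ y) :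
    pairSqBhat x y ≤ 2 * pairEntropy x y := by
  rcases hx.eq_or_lt with rfl | hx
  · simp [pairEntropy, pairSqBhat]
  rcases hy.eq_or_lt with rfl | hy
  · simp [pairEntropy, pairSqBhat]
  rw [pairEntropy_eq_log hx hy]
  have h1 := mul_le_mul_of_nonneg_left
    (Real.one_sub_inv_le_log_of_pos (x := (x + y) / x) (by positivity)) hx.le
  have h2 := mul_le_mul_of_nonneg_left
    (Real.one_sub_inv_le_log_of_pos (x := (x + y) / y) (by positivity)) hy.le
  have h3 : pairSqBhat x y = 2 * (x * (1 - ((x + y) / x)⁻¹) + y * (1 - ((x + y) / y)⁻¹)) := by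
    unfold pairSqBhat; field_simp; ring
  linarith

lemma pairEntropy_le_bhat {x y : ℝ} (hx : 0 ≤ x) (hy : 0 ≤ y) :
    pairEntropy x y ≤ 2 * pairBhat x y := by
  rcases hx.eq_or_lt with rfl | hx
  · simp [pairEntropy, pairBhat]
  rcases hy.eq_or_lt with rfl | hy
  · simp [pairEntropy, pairBhat]
  have key : ∀ {x y : ℝ}, 0 < x → 0 < y → x * Real.log ((x + y) / x) ≤ 2 * √(x * y) := by
    intro x y hx hy
    have h1 := Real.log_le_sub_one_of_pos (x := √((x + y) / x)) (by positivity)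
    rw [Real.log_sqrt (by positivity), Real.sqrt_div (by positivity)] at h1
    have h2 : √(x + y) ≤ √x + √y :=
      Real.sqrt_le_iff.2 ⟨by positivity, by
        nlinarith [Real.sq_sqrt hx.le, Real.sq_sqrt hy.le, Real.sqrt_nonneg x, Real.sqrt_nonneg y]⟩
    rw [Real.sqrt_mul hx.le]
    have hx' : 0 < √x := Real.sqrt_pos.2 hx
    have h3 : √(x + y) / √x - 1 ≤ √y / √x := by
      rw [sub_le_iff_le_add, ← sub_nonneg]
      have : √y / √x + 1 - √(x + y) / √x = (√x + √y - √(x + y)) / √x := by field_simp; ring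
      rw [this]; exact div_nonneg (by linarith) hx'.le
    have h4 : x * (√y / √x) = √x * √y := by
      nth_rewrite 1 [← Real.mul_self_sqrt hx.le]; field_simp
    nlinarith
  rw [pairEntropy_eq_log hx hy]
  have h1 := key hx hy
  have h2 := key hy hx
  rw [add_comm y x, mul_comm y x] at h2
  unfold pairBhat
  linarith

lemma entropy_deficit_le_pairSqDist {x y : ℝ} (hx : 0 ≤ x) (hy : 0 ≤ y) :
    (x + y) * Real.log 2 - pairEntropy x y ≤ pairSqDist x y := by
  have h2 : Real.log 2 ≤ 1 := by linarith [Real.log_two_lt_d9]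
  rcases hx.eq_or_lt with rfl | hx
  · rcases hy.eq_or_lt with rfl | hy
    · simp [pairEntropy, pairSqDist]
    · simp [pairEntropy, pairSqDist]; rw [sq, mul_div_assoc, div_self hy.ne']; nlinarith
  rcases hy.eq_or_lt with rfl | hy
  · simp [pairEntropy, pairSqDist]; rw [sq, mul_div_assoc, div_self hx.ne']; nlinarith
  have h : 0 < x + y := by linarith
  have key : ∀ {x y : ℝ}, 0 < x → 0 < y →
      x * (Real.log 2 - Real.log ((x + y) / x)) ≤ x * (2 * x / (x + y) - 1) := by
    intro x y hx hy
    have := Real.log_le_sub_one_of_pos (x := 2 * x / (x + y)) (by positivity)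
    rw [← Real.log_div (by norm_num) (by positivity)]
    rw [show 2 / ((x + y) / x) = 2 * x / (x + y) by field_simp]
    gcongr
  have h3 := key hx hy
  have h4 := key hy hx
  rw [add_comm y x] at h4
  rw [pairEntropy_eq_log hx hy]
  have h5 : x * (2 * x / (x + y) - 1) + y * (2 * y / (x + y) - 1) = pairSqDist x y := by
    unfold pairSqDist; field_simp; ring
  linarith

lemma pairEntropy_nonneg {x y : ℝ} (hx : 0 ≤ x) (hy : 0 ≤ y) : 0 ≤ pairEntropy x y := by
  linarith [pairSqBhat_le_entropy hx hy, pairSqBhat_nonneg hx hy]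

lemma pairBhat_nonneg (x y : ℝ) : 0 ≤ pairBhat x y := by unfold pairBhat; positivity

lemma pairBhat_le_add {x y : ℝ} (hx : 0 ≤ x) (hy : 0 ≤ y) : pairBhat x y ≤ x + y := by
  unfold pairBhat
  have := two_mul_le_add_sq (√x) (√y)
  rw [Real.sq_sqrt hx, Real.sq_sqrt hy] at this
  rw [Real.sqrt_mul hx]; linarith

lemma add_sub_pairDist_le_pairBhat {x y : ℝ} (hx : 0 ≤ x) (hy : 0 ≤ y) :
    x + y - pairDist x y ≤ pairBhat x y := by
  unfold pairBhat pairDist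
  have hm : x + y - |x - y| = 2 * min x y := by
    rcases le_total x y with h | h
    · rw [min_eq_left h, abs_of_nonpos (by linarith)]; ring
    · rw [min_eq_right h, abs_of_nonneg (by linarith)]; ring
  rw [hm]
  gcongr
  refine Real.le_sqrt_of_sq_le ?_
  rw [sq]
  exact mul_le_mul (min_le_left _ _) (min_le_right _ _) (le_min hx hy) hx

/-! ### One polarization step on joint laws with boundary states -/

lemma sum_zmod_two (f : ZMod 2 → ℝ) : ∑ u, f u = f 0 + f 1 := Fin.sum_univ_two f

/-- The sum of a pair weight `φ` over the values of the observation, for a joint law `p` of a bit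
and an observation. -/
noncomputable def weight {𝒬 : Type*} [Fintype 𝒬] (φ : ℝ → ℝ → ℝ) (p : ZMod 2 → 𝒬 → ℝ) : ℝ :=
  ∑ q, φ (p 0 q) (p 1 q)

/-- `p a b u q` is the joint law of the left boundary state, the right boundary state, a bit and an
observation, and both boundary states have the law `π`, which charges every state. -/
structure IsBlockLaw {𝒮 𝒬 : Type*} [Fintype 𝒮] [Fintype 𝒬] (π : 𝒮 → ℝ)
    (p : 𝒮 → 𝒮 → ZMod 2 → 𝒬 → ℝ) : Prop where
  pi_pos : ∀ b, 0 < π b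
  pi_sum : ∑ b, π b = 1
  nonneg : ∀ a b u q, 0 ≤ p a b u q
  left : ∀ b, ∑ a, ∑ q, (p a b 0 q + p a b 1 q) = π b
  right : ∀ b, ∑ c, ∑ r, (p b c 0 r + p b c 1 r) = π b

section Laws

variable {𝒮 𝒬 : Type*} [Fintype 𝒮] [Fintype 𝒬]

/-- The law of bit and observation, with the boundary states among the observations. -/
def informed (p : 𝒮 → 𝒮 → ZMod 2 → 𝒬 → ℝ) : ZMod 2 → 𝒮 × 𝒮 × 𝒬 → ℝ :=
  fun u x => p x.1 x.2.1 u x.2.2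

/-- The law of bit and observation, ignoring the boundary states. -/
def uninformed (p : 𝒮 → 𝒮 → ZMod 2 → 𝒬 → ℝ) : ZMod 2 → 𝒬 → ℝ :=
  fun u q => ∑ a, ∑ b, p a b u q

/-- The joint law of two adjacent blocks that are independent given the state between them; that
state is summed out. -/
noncomputable def twoBlock (π : 𝒮 → ℝ) (p : 𝒮 → 𝒮 → ZMod 2 → 𝒬 → ℝ) (a c : 𝒮) (u : ZMod 2)
    (q : 𝒬) (v : ZMod 2) (r : 𝒬) : ℝ :=
  ∑ b, p a b u q * p b c v r / π b

/-- The law of the sum of the bits of two adjacent blocks, observed through both observations. -/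
noncomputable def minusLaw (π : 𝒮 → ℝ) (p : 𝒮 → 𝒮 → ZMod 2 → 𝒬 → ℝ) (a c : 𝒮) (u : ZMod 2)
    (x : 𝒬 × 𝒬) : ℝ :=
  twoBlock π p a c u x.1 0 x.2 + twoBlock π p a c (u + 1) x.1 1 x.2

/-- The law of the bit of the second of two adjacent blocks, observed through both observations and
the sum of the bits. -/
noncomputable def plusLaw (π : 𝒮 → ℝ) (p : 𝒮 → 𝒮 → ZMod 2 → 𝒬 → ℝ) (a c : 𝒮) (v : ZMod 2)
    (x : ZMod 2 × 𝒬 × 𝒬) : ℝ :=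
  twoBlock π p a c (x.1 + v) x.2.1 v x.2.2

lemma weight_informed (φ : ℝ → ℝ → ℝ) (p : 𝒮 → 𝒮 → ZMod 2 → 𝒬 → ℝ) :
    weight φ (informed p) = ∑ a, ∑ b, ∑ q, φ (p a b 0 q) (p a b 1 q) := by
  simp only [weight, informed, Fintype.sum_prod_type]

/-- Summing a product over both blocks: the sums factor given the state between the blocks. -/
lemma sum_twoBlock (π : 𝒮 → ℝ) (F G : 𝒮 → 𝒮 → 𝒬 → ℝ) :
    ∑ a, ∑ c, ∑ q, ∑ r, ∑ b, F a b q * G b c r / π b =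
      ∑ b, (∑ a, ∑ q, F a b q) * (∑ c, ∑ r, G b c r) / π b := by
  have h : ∀ b, (∑ a, ∑ q, F a b q) * (∑ c, ∑ r, G b c r) / π b =
      ∑ a, ∑ c, ∑ q, ∑ r, F a b q * G b c r / π b := by
    intro b
    rw [Finset.sum_mul_sum, Finset.sum_div]
    refine Finset.sum_congr rfl fun a _ => ?_
    rw [Finset.sum_div]
    refine Finset.sum_congr rfl fun c _ => ?_
    rw [Finset.sum_mul_sum, Finset.sum_div]
    refine Finset.sum_congr rfl fun q _ => ?_
    rw [Finset.sum_div]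
  simp_rw [h]
  rw [Finset.sum_comm (s := (Finset.univ : Finset 𝒮))]
  rw [Finset.sum_comm]
  conv_rhs => rw [Finset.sum_comm]
  refine Finset.sum_congr rfl fun a _ => ?_
  conv_rhs => rw [Finset.sum_comm]
  refine Finset.sum_congr rfl fun c _ => ?_
  conv_rhs => rw [Finset.sum_comm]
  refine Finset.sum_congr rfl fun q _ => ?_
  rw [Finset.sum_comm]

variable {π : 𝒮 → ℝ} {p : 𝒮 → 𝒮 → ZMod 2 → 𝒬 → ℝ}

namespace IsBlockLaw

variable (h : IsBlockLaw π p)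

include h

lemma pi_le_one (b : 𝒮) : π b ≤ 1 := by
  rw [← h.pi_sum]
  exact Finset.single_le_sum (f := π) (fun i _ => (h.pi_pos i).le) (Finset.mem_univ b)

lemma twoBlock_nonneg (a c : 𝒮) (u : ZMod 2) (q : 𝒬) (v : ZMod 2) (r : 𝒬) :
    0 ≤ twoBlock π p a c u q v r :=
  Finset.sum_nonneg fun b _ =>
    div_nonneg (mul_nonneg (h.nonneg _ _ _ _) (h.nonneg _ _ _ _)) (h.pi_pos b).le

lemma uninformed_nonneg (u : ZMod 2) (q : 𝒬) : 0 ≤ uninformed p u q :=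
  Finset.sum_nonneg fun _ _ => Finset.sum_nonneg fun _ _ => h.nonneg _ _ _ _

lemma sum_informed : weight (· + ·) (informed p) = 1 := by
  rw [weight_informed, Finset.sum_comm]
  simp_rw [h.left, h.pi_sum]

lemma sum_uninformed : weight (· + ·) (uninformed p) = 1 := by
  rw [← h.sum_informed, weight_informed]
  simp only [weight, uninformed, ← Finset.sum_add_distrib]
  rw [Finset.sum_comm]
  refine Finset.sum_congr rfl fun a _ => ?_
  rw [Finset.sum_comm]

/-- Two adjacent blocks are dominated by independent copies: this is the `ψ`-mixing property of the
process. -/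
lemma sum_twoBlock_le {ψ : ℝ} (hψ : ∀ b, (π b)⁻¹ ≤ ψ) (u : ZMod 2) (q : 𝒬) (v : ZMod 2) (r : 𝒬) :
    ∑ a, ∑ c, twoBlock π p a c u q v r ≤ ψ * (uninformed p u q * uninformed p v r) := by
  have h1 : ∑ a, ∑ c, twoBlock π p a c u q v r =
      ∑ b, (π b)⁻¹ * ((∑ a, p a b u q) * ∑ c, p b c v r) := by
    simp only [twoBlock]
    have h2 : ∀ b, (π b)⁻¹ * ((∑ a, p a b u q) * ∑ c, p b c v r) =
        ∑ a, ∑ c, p a b u q * p b c v r / π b := fun b => by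
      rw [Finset.sum_mul_sum, Finset.mul_sum]
      refine Finset.sum_congr rfl fun a _ => ?_
      rw [Finset.mul_sum]
      exact Finset.sum_congr rfl fun c _ => by ring
    simp_rw [h2]
    conv_rhs => rw [Finset.sum_comm]
    exact Finset.sum_congr rfl fun a _ => Finset.sum_comm
  have hl : ∀ b, 0 ≤ ∑ a, p a b u q := fun b => Finset.sum_nonneg fun _ _ => h.nonneg _ _ _ _
  have hr : ∀ b, 0 ≤ ∑ c, p b c v r := fun b => Finset.sum_nonneg fun _ _ => h.nonneg _ _ _ _
  rw [h1, uninformed, uninformed, Finset.sum_comm, Finset.sum_mul, Finset.mul_sum]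
  refine Finset.sum_le_sum fun b _ => ?_
  refine mul_le_mul (hψ b) ?_ (mul_nonneg (hl b) (hr b)) ((inv_pos.2 (h.pi_pos b)).le.trans (hψ b))
  exact mul_le_mul_of_nonneg_left
    (Finset.single_le_sum (f := fun b => ∑ c, p b c v r) (fun b _ => hr b) (Finset.mem_univ b))
    (hl b)

end IsBlockLaw

lemma pairBhat_mono {x y x' y' : ℝ} (hx : 0 ≤ x) (hy : 0 ≤ y) (hxx' : x ≤ x') (hyy' : y ≤ y') :
    pairBhat x y ≤ pairBhat x' y' := by
  unfold pairBhat
  gcongr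
  linarith

lemma pairBhat_comm (x y : ℝ) : pairBhat x y = pairBhat y x := by
  unfold pairBhat; rw [mul_comm x y]

lemma pairBhat_mul {a b c d : ℝ} (ha : 0 ≤ a) (hb : 0 ≤ b) :
    pairBhat (a * c) (b * d) = pairBhat a b * pairBhat c d / 2 := by
  unfold pairBhat
  rw [show a * c * (b * d) = a * b * (c * d) by ring, Real.sqrt_mul (mul_nonneg ha hb)]
  ring

lemma pairBhat_conv_le {a₀ a₁ b₀ b₁ : ℝ} (ha₀ : 0 ≤ a₀) (ha₁ : 0 ≤ a₁) (hb₀ : 0 ≤ b₀)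
    (hb₁ : 0 ≤ b₁) :
    pairBhat (a₀ * b₀ + a₁ * b₁) (a₁ * b₀ + a₀ * b₁) ≤
      pairBhat a₀ a₁ * (b₀ + b₁) + (a₀ + a₁) * pairBhat b₀ b₁ := by
  unfold pairBhat
  rw [show 2 * √(a₀ * a₁) * (b₀ + b₁) + (a₀ + a₁) * (2 * √(b₀ * b₁)) =
    2 * (√(a₀ * a₁) * (b₀ + b₁) + (a₀ + a₁) * √(b₀ * b₁)) by ring]
  refine mul_le_mul_of_nonneg_left ?_ zero_le_two
  refine Real.sqrt_le_iff.2 ⟨by positivity, ?_⟩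
  have h1 := Real.sq_sqrt (mul_nonneg ha₀ ha₁)
  have h2 := Real.sq_sqrt (mul_nonneg hb₀ hb₁)
  set s := √(a₀ * a₁)
  set t := √(b₀ * b₁)
  have hs : 0 ≤ s := Real.sqrt_nonneg _
  have ht : 0 ≤ t := Real.sqrt_nonneg _
  have h3 : 0 ≤ s * (b₀ + b₁) * ((a₀ + a₁) * t) := by positivity
  have h4 : (s * (b₀ + b₁) + (a₀ + a₁) * t) ^ 2 =
    a₀ * a₁ * (b₀ + b₁) ^ 2 + (a₀ + a₁) ^ 2 * (b₀ * b₁) + 2 * (s * (b₀ + b₁) * ((a₀ + a₁) * t)) := by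
    rw [← h1, ← h2]; ring
  rw [h4]
  have h5 : 0 ≤ a₀ * a₁ * (b₀ * b₁) := by positivity
  nlinarith

namespace IsBlockLaw

variable (h : IsBlockLaw π p)

include h

lemma bhat_minus_le {ψ : ℝ} (hψ : ∀ b, (π b)⁻¹ ≤ ψ) (hψ0 : 0 ≤ ψ) :
    weight pairBhat (uninformed (minusLaw π p)) ≤ 2 * ψ * weight pairBhat (uninformed p) := by
  have hP := h.uninformed_nonneg
  have h1 : ∀ u x, uninformed (minusLaw π p) u x ≤ ψ * (uninformed p u x.1 * uninformed p 0 x.2 +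
      uninformed p (u + 1) x.1 * uninformed p 1 x.2) := by
    intro u x
    have e1 := h.sum_twoBlock_le hψ u x.1 0 x.2
    have e2 := h.sum_twoBlock_le hψ (u + 1) x.1 1 x.2
    have : uninformed (minusLaw π p) u x = ∑ a, ∑ c, twoBlock π p a c u x.1 0 x.2 +
        ∑ a, ∑ c, twoBlock π p a c (u + 1) x.1 1 x.2 := by
      simp only [uninformed, minusLaw, Finset.sum_add_distrib]
    rw [this]; linarith
  have h0 : ∀ u x, 0 ≤ uninformed (minusLaw π p) u x := fun u x =>
    Finset.sum_nonneg fun _ _ => Finset.sum_nonneg fun _ _ =>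
      add_nonneg (h.twoBlock_nonneg _ _ _ _ _ _) (h.twoBlock_nonneg _ _ _ _ _ _)
  have h2 : ∀ q r, pairBhat (uninformed (minusLaw π p) 0 (q, r))
      (uninformed (minusLaw π p) 1 (q, r)) ≤
      ψ * (pairBhat (uninformed p 0 q) (uninformed p 1 q) *
          (uninformed p 0 r + uninformed p 1 r) +
        (uninformed p 0 q + uninformed p 1 q) * pairBhat (uninformed p 0 r) (uninformed p 1 r)) := by
    intro q r
    refine (pairBhat_mono (h0 _ _) (h0 _ _) (h1 _ _) (h1 _ _)).trans ?_
    rw [pairBhat_smul hψ0]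
    refine mul_le_mul_of_nonneg_left ?_ hψ0
    exact pairBhat_conv_le (hP _ _) (hP _ _) (hP _ _) (hP _ _)
  have ht := h.sum_uninformed
  unfold weight at ht ⊢
  rw [Fintype.sum_prod_type]
  refine (Finset.sum_le_sum fun q _ => Finset.sum_le_sum fun r _ => h2 q r).trans (le_of_eq ?_)
  simp_rw [← Finset.mul_sum, Finset.sum_add_distrib, ← Finset.mul_sum, ← Finset.sum_mul]
  rw [ht]; ring

lemma bhat_plus_le {ψ : ℝ} (hψ : ∀ b, (π b)⁻¹ ≤ ψ) (hψ0 : 0 ≤ ψ) :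
    weight pairBhat (uninformed (plusLaw π p)) ≤ ψ * weight pairBhat (uninformed p) ^ 2 := by
  have hP := h.uninformed_nonneg
  have h0 : ∀ u x, 0 ≤ uninformed (plusLaw π p) u x := fun u x =>
    Finset.sum_nonneg fun _ _ => Finset.sum_nonneg fun _ _ => h.twoBlock_nonneg _ _ _ _ _ _
  have h1 : ∀ u x, uninformed (plusLaw π p) u x ≤
      ψ * (uninformed p (x.1 + u) x.2.1 * uninformed p u x.2.2) := fun u x =>
    h.sum_twoBlock_le hψ _ _ _ _
  have h2 : ∀ w q r, pairBhat (uninformed (plusLaw π p) 0 (w, q, r))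
      (uninformed (plusLaw π p) 1 (w, q, r)) ≤
      ψ / 2 * (pairBhat (uninformed p w q) (uninformed p (w + 1) q) *
        pairBhat (uninformed p 0 r) (uninformed p 1 r)) := by
    intro w q r
    refine (pairBhat_mono (h0 _ _) (h0 _ _) (h1 _ _) (h1 _ _)).trans (le_of_eq ?_)
    rw [pairBhat_smul hψ0, pairBhat_mul (hP _ _) (hP _ _), add_zero]
    ring
  unfold weight
  simp_rw [Fintype.sum_prod_type]
  refine (Finset.sum_le_sum fun w _ => Finset.sum_le_sum fun q _ =>
    Finset.sum_le_sum fun r _ => h2 w q r).trans (le_of_eq ?_)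
  rw [sum_zmod_two]
  simp_rw [← Finset.mul_sum, ← Finset.sum_mul]
  rw [zero_add, show (1 + 1 : ZMod 2) = 0 from rfl]
  simp_rw [pairBhat_comm (uninformed p 1 _)]
  ring

lemma dist_minus_le {ψ : ℝ} (hψ : ∀ b, (π b)⁻¹ ≤ ψ) :
    weight pairDist (informed (minusLaw π p)) ≤ ψ * weight pairDist (informed p) ^ 2 := by
  set k : 𝒮 → 𝒮 → 𝒬 → ℝ := fun a b q => pairDist (p a b 0 q) (p a b 1 q) with hk
  have hk0 : ∀ a b q, 0 ≤ k a b q := fun a b q => abs_nonneg _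
  have h1 : ∀ a c q r, pairDist (minusLaw π p a c 0 (q, r)) (minusLaw π p a c 1 (q, r)) ≤
      ∑ b, k a b q * k b c r / π b := by
    intro a c q r
    have : minusLaw π p a c 0 (q, r) - minusLaw π p a c 1 (q, r) =
        ∑ b, (p a b 0 q - p a b 1 q) * (p b c 0 r - p b c 1 r) / π b := by
      simp only [minusLaw, twoBlock, zero_add, show (1 + 1 : ZMod 2) = 0 from rfl]
      rw [← Finset.sum_add_distrib, ← Finset.sum_add_distrib, ← Finset.sum_sub_distrib]
      exact Finset.sum_congr rfl fun b _ => by ring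
    rw [pairDist, this]
    refine (Finset.abs_sum_le_sum_abs _ _).trans (le_of_eq (Finset.sum_congr rfl fun b _ => ?_))
    rw [abs_div, abs_mul, abs_of_pos (h.pi_pos b)]
    rfl
  rw [weight_informed, weight_informed]
  simp_rw [Fintype.sum_prod_type]
  refine (Finset.sum_le_sum fun a _ => Finset.sum_le_sum fun c _ => Finset.sum_le_sum fun q _ =>
    Finset.sum_le_sum fun r _ => h1 a c q r).trans ?_
  rw [sum_twoBlock]
  have hl : ∀ b, 0 ≤ ∑ a, ∑ q, k a b q :=
    fun b => Finset.sum_nonneg fun _ _ => Finset.sum_nonneg fun _ _ => hk0 _ _ _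
  have hr : ∀ b, 0 ≤ ∑ c, ∑ r, k b c r :=
    fun b => Finset.sum_nonneg fun _ _ => Finset.sum_nonneg fun _ _ => hk0 _ _ _
  rw [sq]
  nth_rewrite 1 [Finset.sum_comm]
  rw [Finset.sum_mul, Finset.mul_sum]
  refine Finset.sum_le_sum fun b _ => ?_
  rw [div_eq_inv_mul]
  refine mul_le_mul (hψ b) ?_ (mul_nonneg (hl b) (hr b)) ((inv_pos.2 (h.pi_pos b)).le.trans (hψ b))
  exact mul_le_mul_of_nonneg_left
    (Finset.single_le_sum (f := fun b => ∑ c, ∑ r, k b c r) (fun b _ => hr b) (Finset.mem_univ b))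
    (hl b)

/-- A sum over two blocks in which one factor is the mass of its block reduces to a sum over the
other block. -/
lemma sum_mul_mass (F : 𝒮 → 𝒮 → 𝒬 → ℝ) :
    ∑ a, ∑ c, ∑ q, ∑ r, ∑ b, F a b q * (p b c 0 r + p b c 1 r) / π b = ∑ a, ∑ b, ∑ q, F a b q := by
  rw [sum_twoBlock, Finset.sum_comm (s := (Finset.univ : Finset 𝒮))]
  refine Finset.sum_congr rfl fun b _ => ?_
  rw [h.right, mul_div_cancel_right₀ _ (h.pi_pos b).ne']

lemma sum_mass_mul (G : 𝒮 → 𝒮 → 𝒬 → ℝ) :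
    ∑ a, ∑ c, ∑ q, ∑ r, ∑ b, (p a b 0 q + p a b 1 q) * G b c r / π b = ∑ a, ∑ b, ∑ q, G a b q := by
  rw [sum_twoBlock]
  refine Finset.sum_congr rfl fun b _ => ?_
  rw [h.left, mul_div_cancel_left₀ _ (h.pi_pos b).ne']

lemma dist_plus_le :
    weight pairDist (informed (plusLaw π p)) ≤ 2 * weight pairDist (informed p) := by
  set k : 𝒮 → 𝒮 → 𝒬 → ℝ := fun a b q => pairDist (p a b 0 q) (p a b 1 q) with hk
  have hw : ∀ w a b q, p a b w q + p a b (w + 1) q = p a b 0 q + p a b 1 q := by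
    intro w a b q
    fin_cases w
    · rfl
    · exact add_comm _ _
  have hkw : ∀ w a b q, |p a b w q - p a b (w + 1) q| = k a b q := by
    intro w a b q
    fin_cases w
    · rfl
    · exact abs_sub_comm _ _
  have h1 : ∀ w a c q r, pairDist (plusLaw π p a c 0 (w, q, r)) (plusLaw π p a c 1 (w, q, r)) ≤
      (∑ b, k a b q * (p b c 0 r + p b c 1 r) / π b +
        ∑ b, (p a b 0 q + p a b 1 q) * k b c r / π b) / 2 := by
    intro w a c q r
    simp only [plusLaw, twoBlock, pairDist, add_zero]
    rw [← Finset.sum_sub_distrib, ← Finset.sum_add_distrib, Finset.sum_div]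
    refine (Finset.abs_sum_le_sum_abs _ _).trans (Finset.sum_le_sum fun b _ => ?_)
    rw [← sub_div, abs_div, abs_of_pos (h.pi_pos b), ← add_div, div_div, mul_comm (π b),
      ← div_div]
    refine div_le_div_of_nonneg_right ?_ (h.pi_pos b).le
    rw [show p a b w q * p b c 0 r - p a b (w + 1) q * p b c 1 r =
      ((p a b w q - p a b (w + 1) q) * (p b c 0 r + p b c 1 r) +
        (p a b w q + p a b (w + 1) q) * (p b c 0 r - p b c 1 r)) / 2 by ring, abs_div,
      abs_of_pos (zero_lt_two (α := ℝ))]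
    refine div_le_div_of_nonneg_right ((abs_add_le _ _).trans ?_) zero_le_two
    rw [abs_mul, abs_mul, hkw, hw, abs_of_nonneg (add_nonneg (h.nonneg b c 0 r) (h.nonneg b c 1 r)),
      abs_of_nonneg (add_nonneg (h.nonneg a b 0 q) (h.nonneg a b 1 q))]
    rfl
  rw [weight_informed, weight_informed]
  simp_rw [Fintype.sum_prod_type, sum_zmod_two]
  refine (Finset.sum_le_sum fun a _ => Finset.sum_le_sum fun c _ => add_le_add
    (Finset.sum_le_sum fun q _ => Finset.sum_le_sum fun r _ => h1 0 a c q r)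
    (Finset.sum_le_sum fun q _ => Finset.sum_le_sum fun r _ => h1 1 a c q r)).trans (le_of_eq ?_)
  simp_rw [← Finset.sum_add_distrib, add_halves, Finset.sum_add_distrib]
  rw [h.sum_mul_mass k, h.sum_mass_mul k]
  ring

/-- The entropy after a minus step is at least what it is when the middle state is revealed. -/
lemma entropy_minus_ge :
    ∑ a, ∑ c, ∑ q, ∑ r, ∑ b, pairEntropy (p a b 0 q * p b c 0 r + p a b 1 q * p b c 1 r)
        (p a b 0 q * p b c 1 r + p a b 1 q * p b c 0 r) / π b ≤
      weight pairEntropy (informed (minusLaw π p)) := by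
  rw [weight_informed]
  simp_rw [Fintype.sum_prod_type]
  refine Finset.sum_le_sum fun a _ => Finset.sum_le_sum fun c _ => Finset.sum_le_sum fun q _ =>
    Finset.sum_le_sum fun r _ => ?_
  have hn : ∀ a b u q, 0 ≤ p a b u q := h.nonneg
  have hi : ∀ b, 0 ≤ (π b)⁻¹ := fun b => (inv_pos.2 (h.pi_pos b)).le
  simp_rw [div_eq_inv_mul, ← pairEntropy_smul]
  refine (pairEntropy_sum_le Finset.univ
    (fun b => mul_nonneg (hi b) (add_nonneg (mul_nonneg (hn _ _ _ _) (hn _ _ _ _))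
      (mul_nonneg (hn _ _ _ _) (hn _ _ _ _))))
    (fun b => mul_nonneg (hi b) (add_nonneg (mul_nonneg (hn _ _ _ _) (hn _ _ _ _))
      (mul_nonneg (hn _ _ _ _) (hn _ _ _ _))))).trans (le_of_eq ?_)
  simp only [minusLaw, twoBlock, zero_add, show (1 + 1 : ZMod 2) = 0 from rfl]
  rw [← Finset.sum_add_distrib, ← Finset.sum_add_distrib]
  congr 1 <;> exact Finset.sum_congr rfl fun b _ => by ring

lemma entropy_plus_ge :
    ∑ a, ∑ c, ∑ q, ∑ r, ∑ b, (pairEntropy (p a b 0 q * p b c 0 r) (p a b 1 q * p b c 1 r) +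
        pairEntropy (p a b 1 q * p b c 0 r) (p a b 0 q * p b c 1 r)) / π b ≤
      weight pairEntropy (informed (plusLaw π p)) := by
  rw [weight_informed]
  simp_rw [Fintype.sum_prod_type, sum_zmod_two]
  refine Finset.sum_le_sum fun a _ => Finset.sum_le_sum fun c _ => ?_
  rw [← Finset.sum_add_distrib]
  refine Finset.sum_le_sum fun q _ => ?_
  rw [← Finset.sum_add_distrib]
  refine Finset.sum_le_sum fun r _ => ?_
  have hn : ∀ a b u q, 0 ≤ p a b u q := h.nonneg
  have hi : ∀ b, 0 ≤ (π b)⁻¹ := fun b => (inv_pos.2 (h.pi_pos b)).le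
  simp_rw [add_div, Finset.sum_add_distrib, div_eq_inv_mul, ← pairEntropy_smul]
  have key : ∀ w : ZMod 2, ∑ b, pairEntropy ((π b)⁻¹ * (p a b w q * p b c 0 r))
      ((π b)⁻¹ * (p a b (w + 1) q * p b c 1 r)) ≤
      pairEntropy (plusLaw π p a c 0 (w, q, r)) (plusLaw π p a c 1 (w, q, r)) := by
    intro w
    refine (pairEntropy_sum_le Finset.univ
      (fun b => mul_nonneg (hi b) (mul_nonneg (hn _ _ _ _) (hn _ _ _ _)))
      (fun b => mul_nonneg (hi b) (mul_nonneg (hn _ _ _ _) (hn _ _ _ _)))).trans (le_of_eq ?_)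
    simp only [plusLaw, twoBlock, add_zero]
    congr 1 <;> exact Finset.sum_congr rfl fun b _ => by ring
  exact add_le_add (key 0) (key 1)

/-- Conditioned on the boundary states, one polarization step does not decrease the sum of
entropies, since the middle state gets hidden. -/
lemma entropy_step_ge :
    2 * weight pairEntropy (informed p) ≤
      weight pairEntropy (informed (minusLaw π p)) + weight pairEntropy (informed (plusLaw π p)) := by
  refine le_trans (le_of_eq ?_) (add_le_add h.entropy_minus_ge h.entropy_plus_ge)
  simp_rw [← Finset.sum_add_distrib, ← add_div, ← add_assoc, pairEntropy_chain, add_div,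
    Finset.sum_add_distrib, mul_comm (p _ _ 0 _ + p _ _ 1 _) (pairEntropy (p _ _ 0 _) (p _ _ 1 _))]
  have e1 := h.sum_mul_mass fun a b q => pairEntropy (p a b 0 q) (p a b 1 q)
  have e2 := h.sum_mass_mul fun a b q => pairEntropy (p a b 0 q) (p a b 1 q)
  simp_rw [mul_comm (p _ _ 0 _ + p _ _ 1 _) (pairEntropy (p _ _ 0 _) (p _ _ 1 _))] at e2
  rw [e1, e2, weight_informed]
  ring

/-- The entropy gain of a minus step, in terms of the blocks that share the middle state. -/
lemma entropy_minus_gain :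
    weight pairEntropy (informed p) + 1 / 2 * ∑ b, (∑ a, ∑ q, pairSqBhat (p a b 0 q) (p a b 1 q)) *
      (∑ c, ∑ r, pairSqDist (p b c 0 r) (p b c 1 r)) / π b ≤
      weight pairEntropy (informed (minusLaw π p)) := by
  refine le_trans ?_ h.entropy_minus_ge
  rw [← sum_twoBlock π (fun a b q => pairSqBhat (p a b 0 q) (p a b 1 q))
    (fun a b q => pairSqDist (p a b 0 q) (p a b 1 q)), weight_informed,
    ← h.sum_mass_mul fun a b q => pairEntropy (p a b 0 q) (p a b 1 q)]
  simp_rw [Finset.mul_sum, ← Finset.sum_add_distrib]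
  refine Finset.sum_le_sum fun a _ => Finset.sum_le_sum fun c _ => Finset.sum_le_sum fun q _ =>
    Finset.sum_le_sum fun r _ => Finset.sum_le_sum fun b _ => ?_
  rw [← mul_div_assoc, ← add_div, ← mul_assoc]
  exact div_le_div_of_nonneg_right (pairEntropy_conv (h.nonneg _ _ _ _) (h.nonneg _ _ _ _)
    (h.nonneg _ _ _ _) (h.nonneg _ _ _ _)) (h.pi_pos b).le

/-- If all pairs of boundary states have mass at least `κ`, the entropy gain of a minus step is
bounded below unless the block is nearly deterministic or nearly uniform: chaining the pairs
`(a, b)`, `(b, c)`, `(c, d)` compares the bits under any two pairs of boundary states. -/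
lemma entropy_minus_gap {κ : ℝ}
    (hκ : ∀ a b, κ ≤ ∑ q, (p a b 0 q + p a b 1 q)) :
    κ / (4 * Fintype.card 𝒮) *
      (weight pairSqBhat (informed p) * weight pairSqDist (informed p)) ≤
      weight pairEntropy (informed (minusLaw π p)) - weight pairEntropy (informed p) := by
  set r : 𝒮 → 𝒮 → ℝ := fun a b => ∑ q, pairSqBhat (p a b 0 q) (p a b 1 q) with hr
  set t : 𝒮 → 𝒮 → ℝ := fun a b => ∑ q, pairSqDist (p a b 0 q) (p a b 1 q) with ht
  have hr0 : ∀ a b, 0 ≤ r a b := fun a b =>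
    Finset.sum_nonneg fun q _ => pairSqBhat_nonneg (h.nonneg _ _ _ _) (h.nonneg _ _ _ _)
  have ht0 : ∀ a b, 0 ≤ t a b := fun a b =>
    Finset.sum_nonneg fun q _ => pairSqDist_nonneg (h.nonneg _ _ _ _) (h.nonneg _ _ _ _)
  have hrt : ∀ a b, r a b + t a b = ∑ q, (p a b 0 q + p a b 1 q) := fun a b => by
    rw [hr, ht, ← Finset.sum_add_distrib]
    exact Finset.sum_congr rfl fun q _ =>
      pairSqBhat_add_pairSqDist (h.nonneg _ _ _ _) (h.nonneg _ _ _ _)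
  have hm : ∀ a b, r a b + t a b ≤ 1 := fun a b => by
    rw [hrt]
    refine le_trans ?_ (h.pi_le_one b)
    rw [← h.left b]
    exact Finset.single_le_sum (f := fun a => ∑ q, (p a b 0 q + p a b 1 q))
      (fun a _ => Finset.sum_nonneg fun q _ => add_nonneg (h.nonneg _ _ _ _) (h.nonneg _ _ _ _))
      (Finset.mem_univ a)
  set W : ℝ := ∑ a, ∑ b, ∑ c, r a b * t b c with hW
  have hgain : W / 2 ≤
      weight pairEntropy (informed (minusLaw π p)) - weight pairEntropy (informed p) := by
    have h1 := h.entropy_minus_gain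
    have h2 : W ≤ ∑ b, (∑ a, r a b) * (∑ c, t b c) / π b := by
      rw [hW, Finset.sum_comm]
      refine Finset.sum_le_sum fun b _ => ?_
      rw [← Finset.sum_mul_sum, le_div_iff₀ (h.pi_pos b)]
      exact mul_le_of_le_one_right (mul_nonneg (Finset.sum_nonneg fun a _ => hr0 a b)
        (Finset.sum_nonneg fun c _ => ht0 b c)) (h.pi_le_one b)
    linarith
  have hchain : ∀ a b c d, κ * (r a b * t c d) ≤ r a b * t b c + r b c * t c d := by
    intro a b c d
    have h1 : κ ≤ r b c + t b c := (hκ b c).trans (hrt b c).ge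
    have h2 : r a b ≤ 1 := by linarith [hm a b, ht0 a b]
    have h3 : t c d ≤ 1 := by linarith [hm c d, hr0 c d]
    have h4 : κ * (r a b * t c d) ≤ (r b c + t b c) * (r a b * t c d) :=
      mul_le_mul_of_nonneg_right h1 (mul_nonneg (hr0 _ _) (ht0 _ _))
    have h5 : r b c * t c d * r a b ≤ r b c * t c d :=
      mul_le_of_le_one_right (mul_nonneg (hr0 _ _) (ht0 _ _)) h2
    have h6 : r a b * t b c * t c d ≤ r a b * t b c :=
      mul_le_of_le_one_right (mul_nonneg (hr0 _ _) (ht0 _ _)) h3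
    nlinarith
  have hsum : κ * (weight pairSqBhat (informed p) * weight pairSqDist (informed p)) ≤
      2 * Fintype.card 𝒮 * W := by
    rw [weight_informed, weight_informed]
    change κ * ((∑ a, ∑ b, r a b) * ∑ c, ∑ d, t c d) ≤ _
    have e1 : κ * ((∑ a, ∑ b, r a b) * ∑ c, ∑ d, t c d) =
        ∑ a, ∑ b, ∑ c, ∑ d, κ * (r a b * t c d) := by
      simp_rw [← Finset.mul_sum, ← Finset.sum_mul]
    have e2 : ∑ a, ∑ b, ∑ c, ∑ d, (r a b * t b c + r b c * t c d) =
        2 * Fintype.card 𝒮 * W := by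
      simp_rw [Finset.sum_add_distrib, Finset.sum_const, Finset.card_univ, nsmul_eq_mul,
        ← Finset.mul_sum]
      simp_rw [hW, ← Finset.mul_sum]
      ring
    rw [e1, ← e2]
    exact Finset.sum_le_sum fun a _ => Finset.sum_le_sum fun b _ => Finset.sum_le_sum fun c _ =>
      Finset.sum_le_sum fun d _ => hchain a b c d
  have hc : (0 : ℝ) < Fintype.card 𝒮 := by
    rcases isEmpty_or_nonempty 𝒮 with he | hne
    · have := h.pi_sum
      simp at this
    · exact_mod_cast Fintype.card_pos
  refine le_trans ?_ hgain
  rw [div_mul_eq_mul_div, div_le_div_iff₀ (by positivity) two_pos]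
  linarith

end IsBlockLaw

end Laws

/-! ### Recursive structure of the polarization transform -/

lemma kernelPow_apply (n : ℕ) (r c : Fin (2 ^ n)) :
    kernelPow n r c =
      if ∀ k < n, (c : ℕ).testBit k = true → (r : ℕ).testBit k = true then 1 else 0 := by
  induction n with
  | zero =>
    have : r = c := Fin.ext (by have := r.is_lt; have := c.is_lt; omega)
    simp [kernelPow, this, Matrix.one_apply]
  | succ n ih =>
    have hker : ∀ x y : Fin 2, kernel x y =
        if (y : ℕ).testBit 0 = true → (x : ℕ).testBit 0 = true then 1 else 0 := by
      intro x y
      fin_cases x <;> fin_cases y <;> simp [kernel]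
    have htop : ∀ m : ℕ, m.testBit n = (m / 2 ^ n).testBit 0 := fun m => by
      rw [Nat.testBit_div_two_pow, zero_add]
    simp only [kernelPow, Matrix.reindex_apply, Matrix.submatrix_apply, Matrix.kroneckerMap_apply,
      ih, hker, ← ite_and, mul_ite, mul_one, mul_zero]
    refine if_congr ?_ rfl rfl
    simp only [Equiv.symm_trans_apply, finCongr_symm, finCongr_apply, finProdFinEquiv_symm_apply,
      Fin.coe_divNat, Fin.coe_modNat, Fin.val_cast]
    rw [Nat.forall_lt_succ_right, htop, htop]
    constructor
    · rintro ⟨h1, h2⟩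
      refine ⟨fun k hk => ?_, ?_⟩
      · have := h1 k hk
        simpa [Nat.testBit_mod_two_pow, hk] using this
      · exact h2
    · rintro ⟨h1, h2⟩
      refine ⟨fun k hk => ?_, ?_⟩
      · have := h1 k hk
        simpa [Nat.testBit_mod_two_pow, hk] using this
      · exact h2

lemma polarMatrix_apply (n : ℕ) (j i : Fin (2 ^ n)) :
    polarMatrix n j i =
      if ∀ k < n, (i : ℕ).testBit k = true → (j : ℕ).testBit (n - 1 - k) = true then 1 else 0 := by
  -- `r` is the bit reversal of `j`
  let r : Fin (2 ^ n) := ⟨Nat.ofBits fun k : Fin n => (j : ℕ).testBit (n - 1 - k),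
    Nat.ofBits_lt_two_pow _⟩
  have hr : ∀ k < n, (r : ℕ).testBit k = (j : ℕ).testBit (n - 1 - k) := fun k hk =>
    Nat.testBit_ofBits_lt _ k hk
  have hrow : ∀ x : Fin (2 ^ n), bitReversal n j x = if x = r then 1 else 0 := by
    intro x
    simp only [bitReversal, Matrix.of_apply]
    refine if_congr ⟨fun h => ?_, fun h k hk => by rw [h, hr k hk]⟩ rfl rfl
    refine Fin.ext (Nat.eq_of_testBit_eq fun k => ?_)
    rcases lt_or_ge k n with hk | hk
    · rw [h k hk, hr k hk]
    · have h2 : 2 ^ n ≤ 2 ^ k := Nat.pow_le_pow_right two_pos hk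
      rw [Nat.testBit_lt_two_pow (x.is_lt.trans_le h2), Nat.testBit_lt_two_pow (r.is_lt.trans_le h2)]
  rw [polarMatrix, Matrix.mul_apply]
  simp_rw [hrow, ite_mul, one_mul, zero_mul]
  rw [Finset.sum_ite_eq' Finset.univ r, if_pos (Finset.mem_univ r), kernelPow_apply]
  refine if_congr (forall₂_congr fun k hk => ?_) rfl rfl
  rw [hr k hk]

lemma U_eq_sum {Ω : Type*} (X : ℤ → Ω → ZMod 2) (n : ℕ) (i : Fin (2 ^ n)) (ω : Ω) :
    U X n i ω = ∑ j ∈ Finset.range (2 ^ n),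
      if ∀ k < n, (i : ℕ).testBit k = true → j.testBit (n - 1 - k) = true
        then X ((j : ℤ) + 1) ω else 0 := by
  rw [← Fin.sum_univ_eq_sum_range (fun j => if ∀ k < n, (i : ℕ).testBit k = true →
    j.testBit (n - 1 - k) = true then X ((j : ℤ) + 1) ω else 0)]
  simp only [U, Matrix.vecMul, dotProduct, polarMatrix_apply, mul_ite, mul_one, mul_zero]

/-- The index of the parent in the polarization tree. -/
def half {n : ℕ} (k : Fin (2 ^ (n + 1))) : Fin (2 ^ n) :=
  ⟨k / 2, by have := k.is_lt; have := pow_succ 2 n; omega⟩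

/-- The index of the minus child in the polarization tree. Indices start from zero, so the bit
`U_{2j-1}` of the combined block gets an even index. -/
def minusIdx {n : ℕ} (i : Fin (2 ^ n)) : Fin (2 ^ (n + 1)) :=
  ⟨2 * i, by have := i.is_lt; have := pow_succ 2 n; omega⟩

/-- The index of the plus child in the polarization tree. -/
def plusIdx {n : ℕ} (i : Fin (2 ^ n)) : Fin (2 ^ (n + 1)) :=
  ⟨2 * i + 1, by have := i.is_lt; have := pow_succ 2 n; omega⟩

@[simp] lemma half_val {n : ℕ} (k : Fin (2 ^ (n + 1))) : (half k : ℕ) = k / 2 := rfl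

@[simp] lemma half_minusIdx {n : ℕ} (i : Fin (2 ^ n)) : half (minusIdx i) = i := by
  ext; simp [half, minusIdx]

@[simp] lemma half_plusIdx {n : ℕ} (i : Fin (2 ^ n)) : half (plusIdx i) = i := by
  ext; simp [half, plusIdx]; omega

/-- The process `Z` advanced by the block length `2 ^ n`. -/
def nextBlock {α : Type*} (n : ℕ) (Z : ℤ → α) : ℤ → α := fun j => Z (j + 2 ^ n)

lemma U_succ {Ω : Type*} (X : ℤ → Ω → ZMod 2) (n : ℕ) (k : Fin (2 ^ (n + 1))) (ω : Ω) :
    U X (n + 1) k ω =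
      (if (k : ℕ) % 2 = 0 then U X n (half k) ω else 0) + U (nextBlock n X) n (half k) ω := by
  rw [U_eq_sum, U_eq_sum, U_eq_sum]
  refine (congrArg (fun m => Finset.sum (Finset.range m) _)
    ((pow_succ 2 n).trans (mul_two _))).trans ?_
  rw [Finset.sum_range_add]
  have hcond : ∀ j : ℕ, (∀ l < n + 1, (k : ℕ).testBit l = true →
      j.testBit (n + 1 - 1 - l) = true) ↔ (((k : ℕ) % 2 = 1 → j.testBit n = true) ∧
      ∀ l < n, (half k : ℕ).testBit l = true → j.testBit (n - 1 - l) = true) := by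
    intro j
    rw [Nat.forall_lt_succ_left]
    refine and_congr ?_ (forall₂_congr fun l hl => ?_)
    · simp [Nat.testBit_zero]
    · rw [Nat.testBit_succ, half_val, show n + 1 - 1 - (l + 1) = n - 1 - l by omega]
  simp_rw [hcond]
  congr 1
  · split_ifs with h
    · refine Finset.sum_congr rfl fun j hj => if_congr ?_ rfl rfl
      simp [h]
    · refine Finset.sum_eq_zero fun j hj => if_neg ?_
      rintro ⟨h1, -⟩
      have := h1 (by omega)
      rw [Nat.testBit_lt_two_pow (Finset.mem_range.1 hj)] at this
      exact Bool.false_ne_true this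
  · refine Finset.sum_congr rfl fun j hj => ?_
    have hj' := Finset.mem_range.1 hj
    refine if_congr ?_ ?_ rfl
    · have h1 : (2 ^ n + j).testBit n = true := by
        rw [Nat.testBit_two_pow_add_eq, Nat.testBit_lt_two_pow hj']; rfl
      have h2 : ∀ l < n, (2 ^ n + j).testBit (n - 1 - l) = j.testBit (n - 1 - l) := fun l hl =>
        Nat.testBit_two_pow_add_gt (by omega) j
      constructor
      · rintro ⟨-, h⟩ l hl hk
        rw [← h2 l hl]; exact h l hl hk
      · intro h
        refine ⟨fun _ => h1, fun l hl hk => ?_⟩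
        rw [h2 l hl]; exact h l hl hk
    · simp only [nextBlock]
      congr 1
      push_cast; ring

/-- The bits `u`, `v` of two adjacent blocks determine the bits of the combined block. -/
def interleave {m : ℕ} (u v : Fin m → ZMod 2) (k : Fin (2 * m)) : ZMod 2 :=
  (if (k : ℕ) % 2 = 0 then u ⟨k / 2, by have := k.is_lt; omega⟩ else 0) +
    v ⟨k / 2, by have := k.is_lt; omega⟩

lemma interleave_injective {m : ℕ} {u v u' v' : Fin m → ZMod 2}
    (h : interleave u v = interleave u' v') : u = u' ∧ v = v' := by
  have hv : v = v' := by
    funext j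
    have := congrFun h ⟨2 * j + 1, by have := j.is_lt; omega⟩
    have e : (2 * (j : ℕ) + 1) / 2 = j := by omega
    simpa [interleave, e, Nat.add_mod] using this
  refine ⟨?_, hv⟩
  funext j
  have := congrFun h ⟨2 * j, by have := j.is_lt; omega⟩
  simpa [interleave, hv] using this

/-- Concatenation of the side information of two adjacent blocks. -/
def appendBlock {α : Type*} {n : ℕ} (y z : Fin (2 ^ n) → α) (j : Fin (2 ^ (n + 1))) : α :=
  if h : (j : ℕ) < 2 ^ n then y ⟨j, h⟩
  else z ⟨j - 2 ^ n, by have := j.is_lt; have := pow_succ 2 n; omega⟩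

lemma appendBlock_injective {α : Type*} {n : ℕ} {y z y' z' : Fin (2 ^ n) → α}
    (h : appendBlock y z = appendBlock y' z') : y = y' ∧ z = z' := by
  have hp : 2 ^ (n + 1) = 2 ^ n + 2 ^ n := by rw [pow_succ]; ring
  constructor
  · funext j
    have := congrFun h ⟨j, by have := j.is_lt; omega⟩
    simpa [appendBlock] using this
  · funext j
    have := congrFun h ⟨2 ^ n + j, by have := j.is_lt; omega⟩
    simpa [appendBlock] using this

/-- The type of the observations `(U_1^i, Y_1^N)`, `N = 2^n`. -/
abbrev Obs (𝒴 : Type*) (n : ℕ) (i : Fin (2 ^ n)) : Type _ :=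
  (Fin (i : ℕ) → ZMod 2) × (Fin (2 ^ n) → 𝒴)

/-- The observation of the minus child, as a function of the observations of both blocks. -/
def minusObs {𝒴 : Type*} {n : ℕ} {i : Fin (2 ^ n)} (x : Obs 𝒴 n i × Obs 𝒴 n i) :
    Obs 𝒴 (n + 1) (minusIdx i) :=
  (interleave x.1.1 x.2.1, appendBlock x.1.2 x.2.2)

/-- The observation of the plus child, as a function of the sum of the bits and of the
observations of both blocks. -/
def plusObs {𝒴 : Type*} {n : ℕ} {i : Fin (2 ^ n)} (x : ZMod 2 × Obs 𝒴 n i × Obs 𝒴 n i) :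
    Obs 𝒴 (n + 1) (plusIdx i) :=
  (Fin.snoc (α := fun _ => ZMod 2) (interleave x.2.1.1 x.2.2.1) x.1,
    appendBlock x.2.1.2 x.2.2.2)

lemma minusObs_injective {𝒴 : Type*} {n : ℕ} {i : Fin (2 ^ n)} :
    Function.Injective (minusObs (𝒴 := 𝒴) (i := i)) := by
  rintro ⟨⟨u, y⟩, ⟨v, z⟩⟩ ⟨⟨u', y'⟩, ⟨v', z'⟩⟩ h
  obtain ⟨h1, h2⟩ := Prod.ext_iff.1 h
  obtain ⟨rfl, rfl⟩ := interleave_injective h1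
  obtain ⟨rfl, rfl⟩ := appendBlock_injective h2
  rfl

lemma plusObs_injective {𝒴 : Type*} {n : ℕ} {i : Fin (2 ^ n)} :
    Function.Injective (plusObs (𝒴 := 𝒴) (i := i)) := by
  rintro ⟨w, ⟨u, y⟩, ⟨v, z⟩⟩ ⟨w', ⟨u', y'⟩, ⟨v', z'⟩⟩ h
  obtain ⟨h1, h2⟩ := Prod.ext_iff.1 h
  obtain ⟨h3, rfl⟩ := Fin.snoc_injective2 (α := fun _ => ZMod 2) h1
  obtain ⟨rfl, rfl⟩ := interleave_injective h3
  obtain ⟨rfl, rfl⟩ := appendBlock_injective h2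
  rfl

section Trajectory

variable {Ω 𝒴 : Type*} (X : ℤ → Ω → ZMod 2) (Y : ℤ → Ω → 𝒴)

lemma appendBlock_process (n : ℕ) (ω : Ω) :
    (fun j : Fin (2 ^ (n + 1)) => Y (((j : ℕ) : ℤ) + 1) ω) =
      appendBlock (fun j : Fin (2 ^ n) => Y (((j : ℕ) : ℤ) + 1) ω)
        (fun j : Fin (2 ^ n) => nextBlock n Y (((j : ℕ) : ℤ) + 1) ω) := by
  funext j
  unfold appendBlock nextBlock
  split_ifs with h
  · rfl
  · congr 1
    push_cast [Nat.cast_sub (not_lt.1 h)]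
    ring

lemma interleave_process (n : ℕ) (i : Fin (2 ^ n)) (h : 2 * (i : ℕ) ≤ 2 ^ (n + 1)) (ω : Ω) :
    (fun k : Fin (2 * (i : ℕ)) => U X (n + 1) (Fin.castLE h k) ω) =
      interleave (fun k : Fin (i : ℕ) => U X n (Fin.castLE i.is_lt.le k) ω)
        (fun k : Fin (i : ℕ) => U (nextBlock n X) n (Fin.castLE i.is_lt.le k) ω) := by
  funext k
  rw [U_succ]
  rfl

lemma U_minus (n : ℕ) (i : Fin (2 ^ n)) (ω : Ω) :
    U X (n + 1) (minusIdx i) ω = U X n i ω + U (nextBlock n X) n i ω := by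
  rw [U_succ, half_minusIdx, if_pos (by simp [minusIdx])]

lemma U_plus (n : ℕ) (i : Fin (2 ^ n)) (ω : Ω) :
    U X (n + 1) (plusIdx i) ω = U (nextBlock n X) n i ω := by
  rw [U_succ, half_plusIdx, if_neg (by simp [plusIdx, Nat.add_mod]), zero_add]

lemma Q_minus (n : ℕ) (i : Fin (2 ^ n)) (ω : Ω) :
    Q X Y (n + 1) (minusIdx i) ω =
      minusObs (Q X Y n i ω, Q (nextBlock n X) (nextBlock n Y) n i ω) :=
  Prod.ext (interleave_process X n i _ ω) (appendBlock_process Y n ω)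

lemma Q_plus (n : ℕ) (i : Fin (2 ^ n)) (ω : Ω) :
    Q X Y (n + 1) (plusIdx i) ω = plusObs (U X n i ω + U (nextBlock n X) n i ω,
      Q X Y n i ω, Q (nextBlock n X) (nextBlock n Y) n i ω) := by
  refine Prod.ext ?_ (appendBlock_process Y n ω)
  have hlt : 2 * (i : ℕ) ≤ 2 ^ (n + 1) := (minusIdx i).is_lt.le
  change (fun k : Fin (2 * (i : ℕ) + 1) => U X (n + 1) (Fin.castLE (plusIdx i).is_lt.le k) ω) =
    Fin.snoc (α := fun _ => ZMod 2) _ _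
  rw [← U_minus]
  refine (Fin.snoc_init_self (α := fun _ => ZMod 2) _).symm.trans ?_
  exact congrArg₂ (Fin.snoc (α := fun _ => ZMod 2)) (interleave_process X n i hlt ω) rfl

end Trajectory

/-! ### Joint laws of the blocks of a FAIM process -/

lemma measurable_U {Ω : Type*} {m : MeasurableSpace Ω} {X : ℤ → Ω → ZMod 2} {n : ℕ}
    (hX : ∀ j : ℕ, j < 2 ^ n → Measurable (X ((j : ℤ) + 1))) (i : Fin (2 ^ n)) :
    Measurable (U X n i) := by
  rw [show U X n i = fun ω => _ from funext fun ω => U_eq_sum X n i ω]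
  refine Finset.measurable_fun_sum _ fun j hj => ?_
  split_ifs
  · exact hX j (Finset.mem_range.1 hj)
  · exact measurable_const

lemma measurable_Q {Ω 𝒴 : Type*} {m : MeasurableSpace Ω} [MeasurableSpace 𝒴]
    {X : ℤ → Ω → ZMod 2} {Y : ℤ → Ω → 𝒴} {n : ℕ}
    (hX : ∀ j : ℕ, j < 2 ^ n → Measurable (X ((j : ℤ) + 1)))
    (hY : ∀ j : ℕ, j < 2 ^ n → Measurable (Y ((j : ℤ) + 1))) (i : Fin (2 ^ n)) :
    Measurable (Q X Y n i) :=
  Measurable.prodMk (measurable_pi_lambda _ fun _ => measurable_U hX _)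
    (measurable_pi_lambda _ fun j => hY j j.is_lt)

/-- The law of total probability. -/
lemma measureReal_eq_sum_fiber {Ω T : Type*} [MeasurableSpace Ω] [Fintype T] [MeasurableSpace T]
    [MeasurableSingletonClass T] (μ : Measure Ω) [IsFiniteMeasure μ] {f : Ω → T}
    (hf : Measurable f) (p : Ω → Prop) :
    μ.real {ω | p ω} = ∑ t, μ.real {ω | f ω = t ∧ p ω} := by
  have hm : ∀ t, MeasurableSet (f ⁻¹' {t}) := fun t => hf (measurableSet_singleton t)
  have h := sum_measureReal_preimage_singleton (μ := μ.restrict {ω | p ω}) Finset.univ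
    (f := f) (fun t _ => hm t)
  rw [Finset.coe_univ, Set.preimage_univ, measureReal_restrict_apply MeasurableSet.univ,
    Set.univ_inter] at h
  rw [← h]
  refine Finset.sum_congr rfl fun t _ => ?_
  rw [measureReal_restrict_apply (hm t)]
  rfl

section GeneratedAlgebras

variable {Ω 𝒴 𝒮 : Type*} [MeasurableSpace 𝒴] [MeasurableSpace 𝒮]
  (X : ℤ → Ω → ZMod 2) (Y : ℤ → Ω → 𝒴) (S : ℤ → Ω → 𝒮)

/-- The `σ`-algebra generated by the family `(X_l, Y_l, S_{l-1})`, `l < j`. -/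
abbrev past (j : ℤ) : MeasurableSpace Ω :=
  MeasurableSpace.comap (fun ω (l : Set.Iio j) => (X l ω, Y l ω, S (l - 1) ω)) inferInstance

/-- The `σ`-algebra generated by the family `(X_k, Y_k, S_k)`, `k ≥ j`. -/
abbrev future (j : ℤ) : MeasurableSpace Ω :=
  MeasurableSpace.comap (fun ω (k : Set.Ici j) => (X k ω, Y k ω, S k ω)) inferInstance

lemma measurable_past {j l : ℤ} (h : l < j) :
    Measurable[past X Y S j] fun ω => (X l ω, Y l ω, S (l - 1) ω) :=
  (measurable_pi_apply (X := fun _ : Set.Iio j => ZMod 2 × 𝒴 × 𝒮) ⟨l, h⟩).comp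
    (comap_measurable (fun ω (l : Set.Iio j) => (X l ω, Y l ω, S (l - 1) ω)))

lemma measurable_future {j k : ℤ} (h : j ≤ k) :
    Measurable[future X Y S j] fun ω => (X k ω, Y k ω, S k ω) :=
  (measurable_pi_apply (X := fun _ : Set.Ici j => ZMod 2 × 𝒴 × 𝒮) ⟨k, h⟩).comp
    (comap_measurable (fun ω (k : Set.Ici j) => (X k ω, Y k ω, S k ω)))

end GeneratedAlgebras

lemma measureReal_cond {Ω : Type*} [MeasurableSpace Ω] (μ : Measure Ω) {E : Set Ω}
    (hE : MeasurableSet E) (A : Set Ω) : (μ[|E]).real A = (μ.real E)⁻¹ * μ.real (E ∩ A) := by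
  simp [Measure.real, cond_apply hE, ENNReal.toReal_mul]

section FAIM

variable {Ω 𝒴 𝒮 : Type*} [MeasurableSpace Ω] [MeasurableSpace 𝒴] [MeasurableSpace 𝒮]

/-- The joint law of the boundary states, the bit `U_{i+1}` and its observation in the first block
of length `2 ^ n`. -/
noncomputable def blockLaw (μ : Measure Ω) (X : ℤ → Ω → ZMod 2) (Y : ℤ → Ω → 𝒴) (S : ℤ → Ω → 𝒮)
    (n : ℕ) (i : Fin (2 ^ n)) (a b : 𝒮) (u : ZMod 2) (q : Obs 𝒴 n i) : ℝ :=
  μ.real {ω | S 0 ω = a ∧ S (2 ^ n) ω = b ∧ U X n i ω = u ∧ Q X Y n i ω = q}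

/-- The stationary law of the state sequence. -/
noncomputable def stateLaw (μ : Measure Ω) (S : ℤ → Ω → 𝒮) (a : 𝒮) : ℝ := μ.real {ω | S 0 ω = a}

/-- The joint law of the states at distance `k`. -/
noncomputable def statePair (μ : Measure Ω) (S : ℤ → Ω → 𝒮) (k : ℤ) (a b : 𝒮) : ℝ :=
  μ.real {ω | S 0 ω = a ∧ S k ω = b}

namespace IsFAIM

variable {μ : Measure Ω} {X : ℤ → Ω → ZMod 2} {Y : ℤ → Ω → 𝒴} {S : ℤ → Ω → 𝒮}
  (h : IsFAIM μ X Y S)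

include h

/-- The Markov property, for the state at time `k`. -/
lemma markov_mul [MeasurableSingletonClass 𝒮] [IsProbabilityMeasure μ] (k : ℤ) (s : 𝒮)
    {A B : Ω → Prop} (hA : MeasurableSet[past X Y S (k + 1)] {ω | A ω})
    (hB : MeasurableSet[future X Y S (k + 1)] {ω | B ω}) :
    μ.real {ω | S k ω = s ∧ A ω ∧ B ω} * μ.real {ω | S k ω = s} =
      μ.real {ω | S k ω = s ∧ A ω} * μ.real {ω | S k ω = s ∧ B ω} := by
  have hi := (IndepFun_iff _ _ _).1 (h.markov (k + 1) s) _ _ hA hB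
  rw [add_sub_cancel_right] at hi
  have hm : MeasurableSet (S k ⁻¹' {s}) := h.measurable_S k (measurableSet_singleton s)
  rw [cond_apply hm, cond_apply hm, cond_apply hm] at hi
  have e1 : S k ⁻¹' {s} ∩ ({ω | A ω} ∩ {ω | B ω}) = {ω | S k ω = s ∧ A ω ∧ B ω} := rfl
  have e2 : S k ⁻¹' {s} ∩ {ω | A ω} = {ω | S k ω = s ∧ A ω} := rfl
  have e3 : S k ⁻¹' {s} ∩ {ω | B ω} = {ω | S k ω = s ∧ B ω} := rfl
  have e4 : S k ⁻¹' {s} = {ω | S k ω = s} := rfl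
  rw [e1, e2, e3, e4] at hi
  have hr := congrArg ENNReal.toReal hi
  simp only [ENNReal.toReal_mul, ENNReal.toReal_inv] at hr
  change (μ.real {ω | S k ω = s})⁻¹ * μ.real {ω | S k ω = s ∧ A ω ∧ B ω} =
    (μ.real {ω | S k ω = s})⁻¹ * μ.real {ω | S k ω = s ∧ A ω} *
    ((μ.real {ω | S k ω = s})⁻¹ * μ.real {ω | S k ω = s ∧ B ω}) at hr
  rcases eq_or_ne (μ.real {ω | S k ω = s}) 0 with h0 | h0
  · have h1 : μ.real {ω | S k ω = s ∧ A ω} = 0 :=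
      le_antisymm ((measureReal_mono fun ω hω => hω.1).trans h0.le) measureReal_nonneg
    rw [h0, h1]; simp
  · field_simp at hr
    linarith

lemma measureReal_shift [MeasurableSingletonClass 𝒮] (k : ℤ)
    {T : Set (ℤ → ZMod 2 × 𝒴 × 𝒮)} (hT : MeasurableSet T) :
    μ.real {ω | (fun j : ℤ => (X (j + k) ω, Y (j + k) ω, S (j + k) ω)) ∈ T} =
      μ.real {ω | (fun j : ℤ => (X j ω, Y j ω, S j ω)) ∈ T} :=
  congrArg ENNReal.toReal ((h.stationary k).measure_mem_eq hT)

lemma measureReal_state [MeasurableSingletonClass 𝒮] (k : ℤ) (a : 𝒮) :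
    μ.real {ω | S k ω = a} = stateLaw μ S a := by
  have := h.measureReal_shift k (T := {G | (G 0).2.2 = a})
    (((measurable_pi_apply (0 : ℤ)).snd.snd) (measurableSet_singleton a))
  simpa [stateLaw] using this

lemma measureReal_statePair [MeasurableSingletonClass 𝒮] (k l : ℤ) (a b : 𝒮) :
    μ.real {ω | S k ω = a ∧ S (k + l) ω = b} = statePair μ S l a b := by
  have := h.measureReal_shift k (T := {G | (G 0).2.2 = a} ∩ {G | (G l).2.2 = b})
    (MeasurableSet.inter (((measurable_pi_apply (0 : ℤ)).snd.snd) (measurableSet_singleton a))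
      (((measurable_pi_apply l).snd.snd) (measurableSet_singleton b)))
  rw [add_comm k l]
  simpa [statePair] using this

lemma stateLaw_pos [IsProbabilityMeasure μ] (a : 𝒮) : 0 < stateLaw μ S a := by
  obtain ⟨n, -, hn⟩ := h.irreducible a a
  refine measureReal_nonneg.lt_of_ne fun h0 => hn.ne' ?_
  have h1 : μ (S 0 ⁻¹' {a}) = 0 := (measureReal_eq_zero_iff).1 h0.symm
  simp [stepProb, cond_eq_zero_of_meas_eq_zero h1]

lemma inv_stateLaw_le [Fintype 𝒮] [IsProbabilityMeasure μ] (b : 𝒮) :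
    (stateLaw μ S b)⁻¹ ≤ ∑ a, (stateLaw μ S a)⁻¹ :=
  Finset.single_le_sum (f := fun a => (stateLaw μ S a)⁻¹)
    (fun a _ => (inv_pos.2 (h.stateLaw_pos a)).le) (Finset.mem_univ b)

lemma stepProb_eq [MeasurableSingletonClass 𝒮] (n : ℕ) (a b : 𝒮) :
    stepProb μ S n a b = (stateLaw μ S a)⁻¹ * statePair μ S n a b := by
  rw [stepProb, measureReal_cond μ (h.measurable_S 0 (measurableSet_singleton a))]
  rfl

lemma sum_stateLaw [Fintype 𝒮] [MeasurableSingletonClass 𝒮] [IsProbabilityMeasure μ] :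
    ∑ a, stateLaw μ S a = 1 := by
  have := measureReal_eq_sum_fiber μ (h.measurable_S 0) (fun _ => True)
  simpa [stateLaw] using this.symm

lemma sum_statePair [Fintype 𝒮] [MeasurableSingletonClass 𝒮] [IsProbabilityMeasure μ] (k : ℤ)
    (a : 𝒮) : ∑ b, statePair μ S k a b = stateLaw μ S a := by
  have := measureReal_eq_sum_fiber μ (h.measurable_S k) (fun ω => S 0 ω = a)
  rw [stateLaw, this]
  exact Finset.sum_congr rfl fun b _ => congrArg μ.real (Set.ext fun ω => and_comm)

/-- The Chapman–Kolmogorov equation. -/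
lemma statePair_add [Fintype 𝒮] [MeasurableSingletonClass 𝒮] [IsProbabilityMeasure μ] {m k : ℤ}
    (hm : 0 < m) (hk : 0 < k) (a b : 𝒮) :
    statePair μ S (m + k) a b =
      ∑ s, statePair μ S m a s * statePair μ S k s b / stateLaw μ S s := by
  rw [statePair, measureReal_eq_sum_fiber μ (h.measurable_S m)]
  refine Finset.sum_congr rfl fun s _ => ?_
  have hA : MeasurableSet[past X Y S (m + 1)] {ω | S 0 ω = a} := by
    have := (measurable_past X Y S (j := m + 1) (l := 1) (by linarith)).snd.snd
    exact this (measurableSet_singleton a)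
  have hB : MeasurableSet[future X Y S (m + 1)] {ω | S (m + k) ω = b} :=
    (measurable_future X Y S (j := m + 1) (k := m + k) (by omega)).snd.snd
      (measurableSet_singleton b)
  have := h.markov_mul m s hA hB
  rw [h.measureReal_state, h.measureReal_statePair] at this
  rw [eq_div_iff (h.stateLaw_pos s).ne', this]
  congr 1
  exact congrArg μ.real (Set.ext fun ω => and_comm)

lemma stepProb_add [Fintype 𝒮] [MeasurableSingletonClass 𝒮] [IsProbabilityMeasure μ] {m k : ℕ}
    (hm : 0 < m) (hk : 0 < k) (a b : 𝒮) :
    stepProb μ S (m + k) a b = ∑ s, stepProb μ S m a s * stepProb μ S k s b := by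
  rw [h.stepProb_eq, Nat.cast_add, h.statePair_add (by exact_mod_cast hm) (by exact_mod_cast hk),
    Finset.mul_sum]
  refine Finset.sum_congr rfl fun s _ => ?_
  rw [h.stepProb_eq, h.stepProb_eq]
  ring

lemma stepProb_add_pos [Fintype 𝒮] [MeasurableSingletonClass 𝒮] [IsProbabilityMeasure μ] {m k : ℕ}
    (hm : 0 < m) (hk : 0 < k) {a s b : 𝒮} (h1 : 0 < stepProb μ S m a s)
    (h2 : 0 < stepProb μ S k s b) : 0 < stepProb μ S (m + k) a b := by
  rw [h.stepProb_add hm hk]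
  exact (mul_pos h1 h2).trans_le (Finset.single_le_sum
    (f := fun s => stepProb μ S m a s * stepProb μ S k s b)
    (fun s _ => mul_nonneg measureReal_nonneg measureReal_nonneg) (Finset.mem_univ s))

/-- The return times of an aperiodic state form an additive semigroup with greatest common divisor
one, so they comprise all large times. -/
lemma eventually_stepProb_self_pos [Fintype 𝒮] [MeasurableSingletonClass 𝒮]
    [IsProbabilityMeasure μ] (a : 𝒮) : ∀ᶠ m in atTop, 0 < stepProb μ S m a a := by
  set R : Set ℕ := {n | 0 < n ∧ 0 < stepProb μ S n a a} with hR
  have hcl : ∀ m ∈ AddSubmonoid.closure R, m = 0 ∨ m ∈ R := by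
    intro m hm
    induction hm using AddSubmonoid.closure_induction with
    | mem x hx => exact Or.inr hx
    | zero => exact Or.inl rfl
    | add x y _ _ hx hy =>
      rcases hx with rfl | hx
      · simpa using hy
      rcases hy with rfl | hy
      · exact Or.inr (by simpa using hx)
      exact Or.inr ⟨Nat.add_pos_left hx.1 _, h.stepProb_add_pos hx.1 hy.1 hx.2 hy.2⟩
  have hg : Nat.setGcd R = 1 :=
    h.aperiodic a _ fun n h0 hn => Nat.setGcd_dvd_of_mem (s := R) ⟨h0, hn⟩
  obtain ⟨N, hN⟩ := Nat.exists_mem_closure_of_ge R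
  filter_upwards [eventually_ge_atTop N, eventually_gt_atTop 0] with m h1 h2
  rcases hcl m (hN m h1 (by rw [hg]; exact one_dvd m)) with h3 | h3
  · omega
  · exact h3.2

lemma eventually_stepProb_pos [Fintype 𝒮] [MeasurableSingletonClass 𝒮]
    [IsProbabilityMeasure μ] (a b : 𝒮) : ∀ᶠ m in atTop, 0 < stepProb μ S m a b := by
  obtain ⟨k, hk, hab⟩ := h.irreducible a b
  obtain ⟨N, hN⟩ := eventually_atTop.1 (h.eventually_stepProb_self_pos a)
  filter_upwards [eventually_ge_atTop (N + 1 + k)] with m hm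
  have := h.stepProb_add_pos (m := m - k) (by omega) hk (hN (m - k) (by omega)) hab
  rwa [Nat.sub_add_cancel (by omega)] at this

/-- Any two states are jointly charged at all large distances, uniformly in the distance. -/
lemma exists_le_statePair [Fintype 𝒮] [MeasurableSingletonClass 𝒮] [IsProbabilityMeasure μ] :
    ∃ κ > 0, ∀ᶠ m : ℕ in atTop, ∀ a b, κ ≤ statePair μ S m a b := by
  have hne : Nonempty 𝒮 := by
    by_contra he
    rw [not_nonempty_iff] at he
    simpa using h.sum_stateLaw
  have hall : ∀ᶠ m in atTop, ∀ a b, 0 < stepProb μ S m a b :=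
    eventually_all.2 fun a => eventually_all.2 fun b => h.eventually_stepProb_pos a b
  obtain ⟨m₀, hm₀, h0⟩ := (hall.and (eventually_gt_atTop 0)).exists
  obtain ⟨⟨a₁, b₁⟩, h1⟩ := Finite.exists_min fun x : 𝒮 × 𝒮 => stepProb μ S m₀ x.1 x.2
  obtain ⟨a₂, h2⟩ := Finite.exists_min (stateLaw μ S)
  refine ⟨stateLaw μ S a₂ * stepProb μ S m₀ a₁ b₁, mul_pos (h.stateLaw_pos _) (hm₀ _ _), ?_⟩
  filter_upwards [eventually_gt_atTop m₀] with m hm a b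
  have e1 : statePair μ S m a b = stateLaw μ S a * stepProb μ S m a b := by
    rw [h.stepProb_eq, mul_inv_cancel_left₀ (h.stateLaw_pos a).ne']
  have e2 : ∑ s, stepProb μ S (m - m₀) a s = 1 := by
    simp_rw [h.stepProb_eq, ← Finset.mul_sum]
    rw [h.sum_statePair, inv_mul_cancel₀ (h.stateLaw_pos a).ne']
  have e3 : stepProb μ S m₀ a₁ b₁ ≤ stepProb μ S m a b := by
    have := h.stepProb_add (m := m - m₀) (k := m₀) (by omega) h0 a b
    rw [Nat.sub_add_cancel hm.le] at this
    rw [this, ← one_mul (stepProb μ S m₀ a₁ b₁), ← e2, Finset.sum_mul]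
    exact Finset.sum_le_sum fun s _ => mul_le_mul_of_nonneg_left (h1 (s, b)) measureReal_nonneg
  rw [e1]
  exact mul_le_mul (h2 a) e3 measureReal_nonneg measureReal_nonneg

end IsFAIM

end FAIM

section Relabel

variable {𝒮 𝒬 𝒬' : Type*} [Fintype 𝒬] [Fintype 𝒬']

/-- `p'` is the law `p` after an injective relabelling of the observations. -/
structure IsRelabelling (p' : 𝒮 → 𝒮 → ZMod 2 → 𝒬' → ℝ) (p : 𝒮 → 𝒮 → ZMod 2 → 𝒬 → ℝ)
    (e : 𝒬 → 𝒬') : Prop where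
  injective : Function.Injective e
  apply : ∀ a b u x, p' a b u (e x) = p a b u x
  apply_of_notMem : ∀ a b u y, y ∉ Set.range e → p' a b u y = 0

variable {p' : 𝒮 → 𝒮 → ZMod 2 → 𝒬' → ℝ} {p : 𝒮 → 𝒮 → ZMod 2 → 𝒬 → ℝ} {e : 𝒬 → 𝒬'}

lemma IsRelabelling.sum_eq (h : IsRelabelling p' p e) {f : 𝒬' → ℝ} {g : 𝒬 → ℝ}
    (hfg : ∀ x, f (e x) = g x) (hf : ∀ y, y ∉ Set.range e → f y = 0) : ∑ y, f y = ∑ x, g x := by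
  exact (Fintype.sum_of_injective e h.injective g f hf fun x => (hfg x).symm).symm

lemma IsRelabelling.weight_informed [Fintype 𝒮] (h : IsRelabelling p' p e) {φ : ℝ → ℝ → ℝ}
    (hφ : φ 0 0 = 0) : weight φ (informed p') = weight φ (informed p) := by
  rw [Polar.weight_informed, Polar.weight_informed]
  refine Finset.sum_congr rfl fun a _ => Finset.sum_congr rfl fun b _ => ?_
  refine h.sum_eq (fun x => by rw [h.apply, h.apply]) fun y hy => ?_
  rw [h.apply_of_notMem _ _ _ _ hy, h.apply_of_notMem _ _ _ _ hy, hφ]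

lemma IsRelabelling.weight_uninformed [Fintype 𝒮] (h : IsRelabelling p' p e)
    {φ : ℝ → ℝ → ℝ} (hφ : φ 0 0 = 0) : weight φ (uninformed p') = weight φ (uninformed p) := by
  refine h.sum_eq (fun x => ?_) fun y hy => ?_
  · simp only [uninformed, h.apply]
  · simp only [uninformed, h.apply_of_notMem _ _ _ _ hy, Finset.sum_const_zero, hφ]

end Relabel

section FAIM

variable {Ω 𝒴 𝒮 : Type*} [MeasurableSpace Ω] [MeasurableSpace 𝒴] [MeasurableSpace 𝒮]

namespace IsFAIM

variable {μ : Measure Ω} {X : ℤ → Ω → ZMod 2} {Y : ℤ → Ω → 𝒴} {S : ℤ → Ω → 𝒮}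
  (h : IsFAIM μ X Y S)

include h

lemma measurable_nextBlock_U (n : ℕ) (i : Fin (2 ^ n)) : Measurable (U (nextBlock n X) n i) :=
  Polar.measurable_U (X := nextBlock n X) (fun _ _ => h.measurable_X _) i

lemma measurable_U (n : ℕ) (i : Fin (2 ^ n)) : Measurable (U X n i) :=
  Polar.measurable_U (fun _ _ => h.measurable_X _) i

lemma measurable_Q (n : ℕ) (i : Fin (2 ^ n)) : Measurable (Q X Y n i) :=
  Polar.measurable_Q (fun _ _ => h.measurable_X _) (fun _ _ => h.measurable_Y _) i

lemma sum_blockLaw [Fintype 𝒴] [MeasurableSingletonClass 𝒴] [IsProbabilityMeasure μ] (n : ℕ)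
    (i : Fin (2 ^ n)) (a b : 𝒮) :
    ∑ q, (blockLaw μ X Y S n i a b 0 q + blockLaw μ X Y S n i a b 1 q) =
      statePair μ S (2 ^ n) a b := by
  rw [statePair, measureReal_eq_sum_fiber μ (h.measurable_Q n i)]
  refine Finset.sum_congr rfl fun q _ => ?_
  rw [measureReal_eq_sum_fiber μ (h.measurable_U n i), sum_zmod_two]
  congr 1 <;> exact congrArg μ.real (Set.ext fun ω => by simp only [Set.mem_ofPred_eq]; tauto)

/-- The boundary-state-informed Bhattacharyya parameter is the Bhattacharyya parameter with the
boundary states among the observations. -/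
lemma bhattacharyyaBSI_eq [Fintype 𝒴] [Fintype 𝒮] [MeasurableSingletonClass 𝒮]
    [IsProbabilityMeasure μ] (n : ℕ) (i : Fin (2 ^ n)) :
    bhattacharyyaBSI μ (U X n i) (Q X Y n i) (S 0) (S (2 ^ n)) =
      weight pairBhat (informed (blockLaw μ X Y S n i)) := by
  rw [weight_informed, bhattacharyyaBSI]
  refine Finset.sum_congr rfl fun a _ => Finset.sum_congr rfl fun b _ => ?_
  have hE : MeasurableSet {ω | S 0 ω = a ∧ S (2 ^ n) ω = b} :=
    (h.measurable_S 0 (measurableSet_singleton a)).inter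
      (h.measurable_S (2 ^ n) (measurableSet_singleton b))
  rw [bhattacharyya, Finset.mul_sum, Finset.mul_sum]
  refine Finset.sum_congr rfl fun q _ => ?_
  rw [measureReal_cond μ hE, measureReal_cond μ hE]
  change _ * pairBhat _ _ = _
  rw [pairBhat_smul (inv_nonneg.2 measureReal_nonneg)]
  have hset : ∀ u, {ω | S 0 ω = a ∧ S (2 ^ n) ω = b} ∩ {ω | U X n i ω = u ∧ Q X Y n i ω = q} =
      {ω | S 0 ω = a ∧ S (2 ^ n) ω = b ∧ U X n i ω = u ∧ Q X Y n i ω = q} := fun u =>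
    Set.ext fun ω => and_assoc
  rw [hset, hset]
  change _ * (_ * pairBhat (blockLaw μ X Y S n i a b 0 q) (blockLaw μ X Y S n i a b 1 q)) = _
  rcases eq_or_ne (μ.real {ω | S 0 ω = a ∧ S (2 ^ n) ω = b}) 0 with h0 | h0
  · have : blockLaw μ X Y S n i a b 0 q = 0 :=
      le_antisymm ((measureReal_mono fun ω (hω : _ ∧ _ ∧ _) =>
        (⟨hω.1, hω.2.1⟩ : _ ∧ _)).trans h0.le) measureReal_nonneg
    rw [this, h0]
    simp [pairBhat]
  · rw [mul_inv_cancel_left₀ h0]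

variable [MeasurableSingletonClass 𝒴] [MeasurableSingletonClass 𝒮]

lemma measureReal_nextBlock (n : ℕ) (i : Fin (2 ^ n)) (b c : 𝒮) (v : ZMod 2) (r : Obs 𝒴 n i) :
    μ.real {ω | S (2 ^ n) ω = b ∧ S (2 ^ (n + 1)) ω = c ∧ U (nextBlock n X) n i ω = v ∧
      Q (nextBlock n X) (nextBlock n Y) n i ω = r} = blockLaw μ X Y S n i b c v r := by
  -- the coordinate processes on the space of trajectories
  let X' : ℤ → (ℤ → ZMod 2 × 𝒴 × 𝒮) → ZMod 2 := fun j G => (G j).1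
  let Y' : ℤ → (ℤ → ZMod 2 × 𝒴 × 𝒮) → 𝒴 := fun j G => (G j).2.1
  have hX' : ∀ j, Measurable (X' j) := fun j => (measurable_pi_apply j).fst
  have hY' : ∀ j, Measurable (Y' j) := fun j => (measurable_pi_apply j).snd.fst
  have hS' : ∀ j : ℤ, Measurable fun G : ℤ → ZMod 2 × 𝒴 × 𝒮 => (G j).2.2 :=
    fun j => (measurable_pi_apply j).snd.snd
  have := h.measureReal_shift (2 ^ n) (T := {G | (G 0).2.2 = b} ∩ ({G | (G (2 ^ n)).2.2 = c} ∩
    ({G | U X' n i G = v} ∩ {G | Q X' Y' n i G = r})))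
    (((hS' 0) (measurableSet_singleton b)).inter (((hS' (2 ^ n)) (measurableSet_singleton c)).inter
      ((Polar.measurable_U (fun _ _ => hX' _) i (measurableSet_singleton v)).inter
        (Polar.measurable_Q (fun _ _ => hX' _) (fun _ _ => hY' _) i (measurableSet_singleton r)))))
  rw [← zero_add ((2 : ℤ) ^ n), pow_succ, mul_two]
  exact this

lemma measureReal_twoBlocks [IsProbabilityMeasure μ] (n : ℕ) (i : Fin (2 ^ n)) (a b c : 𝒮)
    (u v : ZMod 2) (q r : Obs 𝒴 n i) :
    μ.real {ω | S (2 ^ n) ω = b ∧ (S 0 ω = a ∧ U X n i ω = u ∧ Q X Y n i ω = q) ∧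
      (S (2 ^ (n + 1)) ω = c ∧ U (nextBlock n X) n i ω = v ∧
      Q (nextBlock n X) (nextBlock n Y) n i ω = r)} =
      blockLaw μ X Y S n i a b u q * blockLaw μ X Y S n i b c v r / stateLaw μ S b := by
  have hN : (0 : ℤ) < 2 ^ n := by positivity
  have hcast : ∀ j : ℕ, j < 2 ^ n → (j : ℤ) < 2 ^ n := fun j hj => by exact_mod_cast hj
  have hA : MeasurableSet[past X Y S (2 ^ n + 1)]
      {ω | S 0 ω = a ∧ U X n i ω = u ∧ Q X Y n i ω = q} := by
    have hX : ∀ j : ℕ, j < 2 ^ n → Measurable[past X Y S (2 ^ n + 1)] (X ((j : ℤ) + 1)) :=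
      fun j hj => (measurable_past X Y S (by linarith [hcast j hj])).fst
    have hY : ∀ j : ℕ, j < 2 ^ n → Measurable[past X Y S (2 ^ n + 1)] (Y ((j : ℤ) + 1)) :=
      fun j hj => (measurable_past X Y S (by linarith [hcast j hj])).snd.fst
    have hS := (measurable_past X Y S (j := 2 ^ n + 1) (l := 1) (by linarith)).snd.snd
    exact MeasurableSet.inter (hS (measurableSet_singleton a)) (MeasurableSet.inter
      (Polar.measurable_U hX i (measurableSet_singleton u))
      (Polar.measurable_Q hX hY i (measurableSet_singleton q)))
  have hB : MeasurableSet[future X Y S (2 ^ n + 1)]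
      {ω | S (2 ^ (n + 1)) ω = c ∧ U (nextBlock n X) n i ω = v ∧
      Q (nextBlock n X) (nextBlock n Y) n i ω = r} := by
    have hX : ∀ j : ℕ, j < 2 ^ n →
        Measurable[future X Y S (2 ^ n + 1)] (nextBlock n X ((j : ℤ) + 1)) :=
      fun j hj => (measurable_future X Y S (k := (j : ℤ) + 1 + 2 ^ n) (by linarith)).fst
    have hY : ∀ j : ℕ, j < 2 ^ n →
        Measurable[future X Y S (2 ^ n + 1)] (nextBlock n Y ((j : ℤ) + 1)) :=
      fun j hj => (measurable_future X Y S (k := (j : ℤ) + 1 + 2 ^ n) (by linarith)).snd.fst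
    have hS := (measurable_future X Y S (j := 2 ^ n + 1) (k := 2 ^ (n + 1))
      (by rw [pow_succ]; linarith)).snd.snd
    exact MeasurableSet.inter (hS (measurableSet_singleton c)) (MeasurableSet.inter
      (Polar.measurable_U hX i (measurableSet_singleton v))
      (Polar.measurable_Q hX hY i (measurableSet_singleton r)))
  have := h.markov_mul (2 ^ n) b hA hB
  rw [h.measureReal_state, h.measureReal_nextBlock] at this
  rw [eq_div_iff (h.stateLaw_pos b).ne', this]
  congr 1
  exact congrArg μ.real (Set.ext fun ω => and_left_comm)

variable [Fintype 𝒮] [IsProbabilityMeasure μ]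

lemma isBlockLaw [Fintype 𝒴] (n : ℕ) (i : Fin (2 ^ n)) :
    IsBlockLaw (stateLaw μ S) (blockLaw μ X Y S n i) where
  pi_pos := h.stateLaw_pos
  pi_sum := h.sum_stateLaw
  nonneg _ _ _ _ := measureReal_nonneg
  left b := by
    simp_rw [h.sum_blockLaw]
    rw [← h.measureReal_state (2 ^ n) b, measureReal_eq_sum_fiber μ (h.measurable_S 0)]
    rfl
  right b := by
    simp_rw [h.sum_blockLaw]
    exact h.sum_statePair _ b

lemma isRelabelling_minus (n : ℕ) (i : Fin (2 ^ n)) :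
    IsRelabelling (blockLaw μ X Y S (n + 1) (minusIdx i))
      (minusLaw (stateLaw μ S) (blockLaw μ X Y S n i)) minusObs where
  injective := minusObs_injective
  apply a c u x := by
    obtain ⟨q, r⟩ := x
    have hz : ∀ x v u : ZMod 2, x + v = u ↔ x = u + v := by decide
    have key : ∀ v, μ.real {ω | U (nextBlock n X) n i ω = v ∧ S 0 ω = a ∧ S (2 ^ (n + 1)) ω = c ∧
        U X (n + 1) (minusIdx i) ω = u ∧ Q X Y (n + 1) (minusIdx i) ω = minusObs (q, r)} =
        twoBlock (stateLaw μ S) (blockLaw μ X Y S n i) a c (u + v) q v r := by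
      intro v
      rw [measureReal_eq_sum_fiber μ (h.measurable_S (2 ^ n)), twoBlock]
      refine Finset.sum_congr rfl fun b _ => ?_
      rw [← h.measureReal_twoBlocks]
      refine congrArg μ.real (Set.ext fun ω => ?_)
      simp only [Set.mem_ofPred_eq, U_minus, Q_minus, minusObs_injective.eq_iff, Prod.mk.injEq]
      constructor
      · rintro ⟨h1, h2, h3, h4, h5, h6, h7⟩
        exact ⟨h1, ⟨h3, (hz _ _ _).1 (h2 ▸ h5), h6⟩, h4, h2, h7⟩
      · rintro ⟨h1, ⟨h3, h5, h6⟩, h4, h2, h7⟩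
        exact ⟨h1, h2, h3, h4, by rw [h2]; exact (hz _ _ _).2 h5, h6, h7⟩
    rw [blockLaw, measureReal_eq_sum_fiber μ (h.measurable_nextBlock_U n i), sum_zmod_two, key, key,
      add_zero, minusLaw]
  apply_of_notMem a c u y hy := by
    rw [blockLaw, show {ω | _} = (∅ : Set Ω) from Set.eq_empty_of_forall_notMem fun ω hω =>
      hy ⟨_, (Q_minus X Y n i ω).symm.trans hω.2.2.2⟩, measureReal_empty]

lemma isRelabelling_plus (n : ℕ) (i : Fin (2 ^ n)) :
    IsRelabelling (blockLaw μ X Y S (n + 1) (plusIdx i))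
      (plusLaw (stateLaw μ S) (blockLaw μ X Y S n i)) plusObs where
  injective := plusObs_injective
  apply a c v x := by
    obtain ⟨w, q, r⟩ := x
    have hz : ∀ x v u : ZMod 2, x + v = u ↔ x = u + v := by decide
    rw [blockLaw, measureReal_eq_sum_fiber μ (h.measurable_S (2 ^ n)), plusLaw, twoBlock]
    refine Finset.sum_congr rfl fun b _ => ?_
    rw [← h.measureReal_twoBlocks]
    refine congrArg μ.real (Set.ext fun ω => ?_)
    simp only [Set.mem_ofPred_eq, U_plus, Q_plus, plusObs_injective.eq_iff, Prod.mk.injEq]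
    constructor
    · rintro ⟨h1, h3, h4, h2, h5, h6, h7⟩
      exact ⟨h1, ⟨h3, (hz _ _ _).1 (h2 ▸ h5), h6⟩, h4, h2, h7⟩
    · rintro ⟨h1, ⟨h3, h5, h6⟩, h4, h2, h7⟩
      exact ⟨h1, h3, h4, h2, by rw [h2]; exact (hz _ _ _).2 h5, h6, h7⟩
  apply_of_notMem a c u y hy := by
    rw [blockLaw, show {ω | _} = (∅ : Set Ω) from Set.eq_empty_of_forall_notMem fun ω hω =>
      hy ⟨_, (Q_plus X Y n i ω).symm.trans hω.2.2.2⟩, measureReal_empty]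

end IsFAIM

end FAIM

/-! ### Comparison of entropy, Bhattacharyya parameter and total variation -/

/-- `p` is the joint law of a bit and an observation. -/
structure IsLaw {𝒬 : Type*} [Fintype 𝒬] (p : ZMod 2 → 𝒬 → ℝ) : Prop where
  nonneg : ∀ u q, 0 ≤ p u q
  sum_eq : weight (· + ·) p = 1

lemma weight_bhat_nonneg {𝒬 : Type*} [Fintype 𝒬] (p : ZMod 2 → 𝒬 → ℝ) : 0 ≤ weight pairBhat p :=
  Finset.sum_nonneg fun _ _ => pairBhat_nonneg _ _

lemma weight_dist_nonneg {𝒬 : Type*} [Fintype 𝒬] (p : ZMod 2 → 𝒬 → ℝ) : 0 ≤ weight pairDist p :=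
  Finset.sum_nonneg fun _ _ => abs_nonneg _

namespace IsLaw

variable {𝒬 : Type*} [Fintype 𝒬] {p : ZMod 2 → 𝒬 → ℝ} (h : IsLaw p)

include h

lemma bhat_sq_le : weight pairBhat p ^ 2 ≤ weight pairSqBhat p := by
  have := Finset.sum_sq_le_sum_mul_sum_of_sq_le_mul Finset.univ
    (r := fun q => pairBhat (p 0 q) (p 1 q)) (f := fun q => pairSqBhat (p 0 q) (p 1 q))
    (g := fun q => p 0 q + p 1 q)
    (fun q _ => pairSqBhat_nonneg (h.nonneg _ _) (h.nonneg _ _))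
    (fun q _ => add_nonneg (h.nonneg _ _) (h.nonneg _ _)) (fun q _ => by
      have h0 := h.nonneg 0 q
      have h1 := h.nonneg 1 q
      unfold pairBhat pairSqBhat
      rw [mul_pow, Real.sq_sqrt (mul_nonneg h0 h1)]
      rcases (add_nonneg h0 h1).eq_or_lt with hs | hs
      · have : p 0 q = 0 := by linarith
        rw [this]; simp
      · refine le_of_eq ?_; field_simp; ring)
  rwa [show ∑ q, (p 0 q + p 1 q) = 1 from h.sum_eq, mul_one] at this

lemma dist_sq_le : weight pairDist p ^ 2 ≤ weight pairSqDist p := by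
  have := Finset.sum_sq_le_sum_mul_sum_of_sq_le_mul Finset.univ
    (r := fun q => pairDist (p 0 q) (p 1 q)) (f := fun q => pairSqDist (p 0 q) (p 1 q))
    (g := fun q => p 0 q + p 1 q)
    (fun q _ => pairSqDist_nonneg (h.nonneg _ _) (h.nonneg _ _))
    (fun q _ => add_nonneg (h.nonneg _ _) (h.nonneg _ _)) (fun q _ => by
      have h0 := h.nonneg 0 q
      have h1 := h.nonneg 1 q
      unfold pairDist pairSqDist
      rw [sq_abs]
      rcases (add_nonneg h0 h1).eq_or_lt with hs | hs
      · have h2 : p 0 q = 0 := by linarith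
        have h3 : p 1 q = 0 := by linarith
        rw [h2, h3]; simp
      · refine le_of_eq ?_; field_simp)
  rwa [show ∑ q, (p 0 q + p 1 q) = 1 from h.sum_eq, mul_one] at this

lemma sqBhat_le_entropy : weight pairSqBhat p ≤ 2 * weight pairEntropy p := by
  rw [weight, weight, Finset.mul_sum]
  exact Finset.sum_le_sum fun q _ => pairSqBhat_le_entropy (h.nonneg _ _) (h.nonneg _ _)

lemma entropy_le_bhat : weight pairEntropy p ≤ 2 * weight pairBhat p := by
  rw [weight, weight, Finset.mul_sum]
  exact Finset.sum_le_sum fun q _ => pairEntropy_le_bhat (h.nonneg _ _) (h.nonneg _ _)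

lemma entropy_deficit_eq : Real.log 2 - weight pairEntropy p =
    ∑ q, ((p 0 q + p 1 q) * Real.log 2 - pairEntropy (p 0 q) (p 1 q)) := by
  rw [Finset.sum_sub_distrib, ← Finset.sum_mul, show ∑ q, (p 0 q + p 1 q) = 1 from h.sum_eq,
    one_mul, weight]

lemma sqDist_le_entropy_deficit :
    weight pairSqDist p ≤ 2 * (Real.log 2 - weight pairEntropy p) := by
  rw [h.entropy_deficit_eq, weight, Finset.mul_sum]
  exact Finset.sum_le_sum fun q _ => pairSqDist_le_entropy (h.nonneg _ _) (h.nonneg _ _)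

lemma entropy_deficit_le_sqDist : Real.log 2 - weight pairEntropy p ≤ weight pairSqDist p := by
  rw [h.entropy_deficit_eq, weight]
  exact Finset.sum_le_sum fun q _ => entropy_deficit_le_pairSqDist (h.nonneg _ _) (h.nonneg _ _)

lemma one_sub_dist_le_bhat : 1 - weight pairDist p ≤ weight pairBhat p := by
  rw [← h.sum_eq, weight, weight, weight, ← Finset.sum_sub_distrib]
  exact Finset.sum_le_sum fun q _ => add_sub_pairDist_le_pairBhat (h.nonneg _ _) (h.nonneg _ _)

lemma bhat_le_one : weight pairBhat p ≤ 1 := by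
  rw [← h.sum_eq]
  exact Finset.sum_le_sum fun q _ => pairBhat_le_add (h.nonneg _ _) (h.nonneg _ _)

lemma dist_le_one : weight pairDist p ≤ 1 := by
  rw [← h.sum_eq]
  refine Finset.sum_le_sum fun q _ => abs_sub_le_iff.2 ⟨?_, ?_⟩ <;>
    linarith [h.nonneg 0 q, h.nonneg 1 q]

lemma entropy_nonneg : 0 ≤ weight pairEntropy p :=
  Finset.sum_nonneg fun _ _ => pairEntropy_nonneg (h.nonneg _ _) (h.nonneg _ _)

lemma sqDist_nonneg : 0 ≤ weight pairSqDist p :=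
  Finset.sum_nonneg fun _ _ => pairSqDist_nonneg (h.nonneg _ _) (h.nonneg _ _)

lemma entropy_le_log_two : weight pairEntropy p ≤ Real.log 2 := by
  linarith [h.sqDist_le_entropy_deficit, h.sqDist_nonneg]

/-- Entropy bounded away from its extreme values bounds both squared weights away from zero. -/
lemma entropy_sq_mul_deficit_le :
    (weight pairEntropy p / 2) ^ 2 * (Real.log 2 - weight pairEntropy p) ≤
      weight pairSqBhat p * weight pairSqDist p := by
  have h1 : (weight pairEntropy p / 2) ^ 2 ≤ weight pairSqBhat p := by
    refine le_trans ?_ h.bhat_sq_le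
    exact pow_le_pow_left₀ (by linarith [h.entropy_nonneg]) (by linarith [h.entropy_le_bhat]) 2
  exact mul_le_mul h1 h.entropy_deficit_le_sqDist (sub_nonneg.2 h.entropy_le_log_two)
    ((sq_nonneg _).trans h1)

end IsLaw

namespace IsBlockLaw

variable {𝒮 𝒬 : Type*} [Fintype 𝒮] [Fintype 𝒬] {π : 𝒮 → ℝ} {p : 𝒮 → 𝒮 → ZMod 2 → 𝒬 → ℝ}
  (h : IsBlockLaw π p)

include h

lemma isLaw_informed : IsLaw (informed p) := ⟨fun _ _ => h.nonneg _ _ _ _, h.sum_informed⟩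

lemma isLaw_uninformed : IsLaw (uninformed p) := ⟨h.uninformed_nonneg, h.sum_uninformed⟩

/-- Additional observations lower every superadditive weight. -/
lemma informed_le_uninformed {φ : ℝ → ℝ → ℝ}
    (hφ : ∀ {f g : 𝒮 → ℝ}, (∀ i, 0 ≤ f i) → (∀ i, 0 ≤ g i) →
      ∑ i, φ (f i) (g i) ≤ φ (∑ i, f i) (∑ i, g i)) :
    weight φ (informed p) ≤ weight φ (uninformed p) := by
  rw [weight_informed]
  simp_rw [Finset.sum_comm (s := (Finset.univ : Finset 𝒮)) (t := (Finset.univ : Finset 𝒬))]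
  refine Finset.sum_le_sum fun q _ => le_trans (Finset.sum_le_sum fun a _ =>
    hφ (fun b => h.nonneg a b 0 q) (fun b => h.nonneg a b 1 q)) ?_
  exact hφ (fun a => Finset.sum_nonneg fun b _ => h.nonneg a b 0 q)
    (fun a => Finset.sum_nonneg fun b _ => h.nonneg a b 1 q)

end IsBlockLaw

/-! ### Entropy of finite-valued random variables -/

section Shannon

variable {Ω : Type*} [MeasurableSpace Ω]

/-- The Shannon entropy, in nats, of a finite-valued random variable. -/
noncomputable def shannon {T : Type*} [Fintype T] (μ : Measure Ω) (f : Ω → T) : ℝ :=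
  ∑ t, Real.negMulLog (μ.real {ω | f ω = t})

lemma shannon_comp_injective {T T' : Type*} [Fintype T] [Fintype T'] (μ : Measure Ω) (f : Ω → T)
    {e : T → T'} (he : Function.Injective e) : shannon μ (fun ω => e (f ω)) = shannon μ f := by
  refine (Fintype.sum_of_injective e he _ _ (fun t ht => ?_) fun t => ?_).symm
  · rw [show {ω | e (f ω) = t} = ∅ from Set.eq_empty_of_forall_notMem fun ω hω => ht ⟨_, hω⟩]
    simp
  · simp only [he.eq_iff]

lemma negMulLog_add_le {x y : ℝ} (hx : 0 ≤ x) (hy : 0 ≤ y) :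
    Real.negMulLog (x + y) ≤ Real.negMulLog x + Real.negMulLog y := by
  have := pairEntropy_nonneg hx hy
  unfold pairEntropy at this
  linarith

lemma negMulLog_sum_le {ι : Type*} (s : Finset ι) {f : ι → ℝ} (hf : ∀ i, 0 ≤ f i) :
    Real.negMulLog (∑ i ∈ s, f i) ≤ ∑ i ∈ s, Real.negMulLog (f i) := by
  classical
  induction s using Finset.induction_on with
  | empty => simp
  | insert a s ha ih =>
    rw [Finset.sum_insert ha, Finset.sum_insert ha]
    linarith [negMulLog_add_le (hf a) (Finset.sum_nonneg fun i (_ : i ∈ s) => hf i)]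

/-- Among the decompositions of a mass, the uniform one has maximal entropy. -/
lemma sum_negMulLog_le {ι : Type*} [Fintype ι] [Nonempty ι] {f : ι → ℝ} (hf : ∀ i, 0 ≤ f i) :
    ∑ i, Real.negMulLog (f i) ≤
      Real.negMulLog (∑ i, f i) + (∑ i, f i) * Real.log (Fintype.card ι) := by
  have hc : (0 : ℝ) < Fintype.card ι := by exact_mod_cast Fintype.card_pos
  have := Real.concaveOn_negMulLog.le_map_sum (t := Finset.univ)
    (w := fun _ : ι => (Fintype.card ι : ℝ)⁻¹) (p := f) (fun _ _ => by positivity)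
    (by simp) (fun i _ => hf i)
  simp only [smul_eq_mul, ← Finset.mul_sum] at this
  rw [Real.negMulLog_mul] at this
  have h2 := mul_le_mul_of_nonneg_left this hc.le
  rw [mul_inv_cancel_left₀ hc.ne'] at h2
  refine h2.trans (le_of_eq ?_)
  rw [Real.negMulLog, Real.log_inv]
  field_simp
  ring

variable (μ : Measure Ω) [IsFiniteMeasure μ]

lemma shannon_le_prodMk {T R : Type*} [Fintype T] [Fintype R] [MeasurableSpace R]
    [MeasurableSingletonClass R] (f : Ω → T) {s : Ω → R} (hs : Measurable s) :
    shannon μ f ≤ shannon μ fun ω => (s ω, f ω) := by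
  unfold shannon
  rw [Fintype.sum_prod_type_right]
  refine Finset.sum_le_sum fun t _ => ?_
  rw [measureReal_eq_sum_fiber μ hs]
  simp only [Prod.mk.injEq]
  exact negMulLog_sum_le _ fun _ => measureReal_nonneg

lemma shannon_prodMk_le {μ : Measure Ω} [IsProbabilityMeasure μ] {T R : Type*} [Fintype T]
    [MeasurableSpace T] [MeasurableSingletonClass T] [Fintype R] [Nonempty R] [MeasurableSpace R]
    [MeasurableSingletonClass R] {f : Ω → T} (hf : Measurable f) {s : Ω → R} (hs : Measurable s) :
    (shannon μ fun ω => (s ω, f ω)) ≤ shannon μ f + Real.log (Fintype.card R) := by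
  have h1 : ∑ t, μ.real {ω | f ω = t} = 1 := by
    have := measureReal_eq_sum_fiber μ hf fun _ => True
    simpa using this.symm
  unfold shannon
  rw [Fintype.sum_prod_type_right]
  conv_rhs => rw [← one_mul (Real.log _), ← h1, Finset.sum_mul, ← Finset.sum_add_distrib]
  refine Finset.sum_le_sum fun t _ => ?_
  rw [measureReal_eq_sum_fiber μ hs]
  simp only [Prod.mk.injEq]
  exact sum_negMulLog_le fun _ => measureReal_nonneg

/-- The chain rule of entropy, for a bit and an observation. -/
lemma weight_entropy_eq {𝒬 : Type*} [Fintype 𝒬] {V : Ω → ZMod 2} (hV : Measurable V) (R : Ω → 𝒬) :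
    weight pairEntropy (fun u q => μ.real {ω | V ω = u ∧ R ω = q}) =
      shannon μ (fun ω => (V ω, R ω)) - shannon μ R := by
  unfold shannon weight
  rw [Fintype.sum_prod_type_right, ← Finset.sum_sub_distrib]
  refine Finset.sum_congr rfl fun q _ => ?_
  rw [measureReal_eq_sum_fiber μ hV, sum_zmod_two, sum_zmod_two, pairEntropy]
  simp only [Prod.mk.injEq]

end Shannon

/-- The bits `U_1, …, U_k`, padded by zeros beyond the block. -/
def bitPrefix {Ω : Type*} (X : ℤ → Ω → ZMod 2) (n k : ℕ) (ω : Ω) (j : Fin k) : ZMod 2 :=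
  if h : (j : ℕ) < 2 ^ n then U X n ⟨j, h⟩ ω else 0

/-- The observed symbols `Y_1, …, Y_N`, `N = 2 ^ n`. -/
def sideBlock {Ω 𝒴 : Type*} (Y : ℤ → Ω → 𝒴) (n : ℕ) (ω : Ω) (j : Fin (2 ^ n)) : 𝒴 := Y (((j : ℕ) : ℤ) + 1) ω

lemma Q_eq {Ω 𝒴 : Type*} (X : ℤ → Ω → ZMod 2) (Y : ℤ → Ω → 𝒴) (n : ℕ) (i : Fin (2 ^ n))
    (ω : Ω) : Q X Y n i ω = (bitPrefix X n i ω, sideBlock Y n ω) := by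
  refine Prod.ext (funext fun k => ?_) rfl
  simp only [bitPrefix, dif_pos (k.is_lt.trans i.is_lt)]
  rfl

lemma bitPrefix_succ {Ω : Type*} (X : ℤ → Ω → ZMod 2) (n : ℕ) (i : Fin (2 ^ n))
    (ω : Ω) : bitPrefix X n (i + 1) ω =
      Fin.snoc (α := fun _ => ZMod 2) (bitPrefix X n i ω) (U X n i ω) := by
  refine (Fin.snoc_init_self (α := fun _ => ZMod 2) _).symm.trans ?_
  refine congrArg₂ (Fin.snoc (α := fun _ => ZMod 2)) rfl ?_
  simp [bitPrefix]

section FAIM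

variable {Ω 𝒴 𝒮 : Type*} [MeasurableSpace Ω] [MeasurableSpace 𝒴] [MeasurableSpace 𝒮]

namespace IsFAIM

variable {μ : Measure Ω} {X : ℤ → Ω → ZMod 2} {Y : ℤ → Ω → 𝒴} {S : ℤ → Ω → 𝒮}
  (h : IsFAIM μ X Y S) [Fintype 𝒴] [Fintype 𝒮]
  [MeasurableSingletonClass 𝒮] [IsProbabilityMeasure μ]

include h

lemma weight_uninformed (φ : ℝ → ℝ → ℝ) (n : ℕ) (i : Fin (2 ^ n)) :
    weight φ (uninformed (blockLaw μ X Y S n i)) =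
      weight φ (fun u q => μ.real {ω | U X n i ω = u ∧ Q X Y n i ω = q}) := by
  have : ∀ u q, uninformed (blockLaw μ X Y S n i) u q =
      μ.real {ω | U X n i ω = u ∧ Q X Y n i ω = q} := by
    intro u q
    rw [measureReal_eq_sum_fiber μ (h.measurable_S 0)]
    refine Finset.sum_congr rfl fun a _ => ?_
    rw [measureReal_eq_sum_fiber μ (h.measurable_S (2 ^ n))]
    refine Finset.sum_congr rfl fun b _ => congrArg μ.real (Set.ext fun ω => and_left_comm)
  simp only [weight, this]

/-- Summed over all bits of a block, conditioning on the two boundary states changes the entropies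
by a bounded amount, uniformly in the block length. -/
lemma sum_entropy_sub_le [MeasurableSingletonClass 𝒴] (n : ℕ) :
    ∑ i, (weight pairEntropy (uninformed (blockLaw μ X Y S n i)) -
      weight pairEntropy (informed (blockLaw μ X Y S n i))) ≤
      Real.log (Fintype.card (𝒮 × 𝒮)) := by
  have hne : Nonempty (𝒮 × 𝒮) := by
    obtain ⟨ω⟩ := nonempty_of_isProbabilityMeasure μ
    exact ⟨S 0 ω, S 0 ω⟩
  set s : Ω → 𝒮 × 𝒮 := fun ω => (S 0 ω, S (2 ^ n) ω) with hs
  have hsm : Measurable s := (h.measurable_S 0).prodMk (h.measurable_S _)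
  have hYm : Measurable (sideBlock Y n) := measurable_pi_lambda _ fun j => h.measurable_Y _
  set E : ℕ → ℝ := fun k => shannon μ fun ω => (bitPrefix X n k ω, sideBlock Y n ω) with hE
  set F : ℕ → ℝ := fun k => shannon μ fun ω => (s ω, bitPrefix X n k ω, sideBlock Y n ω) with hF
  have e1 : ∀ i : Fin (2 ^ n), weight pairEntropy (uninformed (blockLaw μ X Y S n i)) =
      E (i + 1) - E i := by
    intro i
    rw [h.weight_uninformed, weight_entropy_eq μ (h.measurable_U n i)]
    congr 1
    · have he : Function.Injective fun x : ZMod 2 × Obs 𝒴 n i =>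
          ((Fin.snoc (α := fun _ => ZMod 2) x.2.1 x.1 : Fin (i + 1) → ZMod 2), x.2.2) := by
        rintro ⟨u, p, y⟩ ⟨u', p', y'⟩ hx
        obtain ⟨h1, h2⟩ := Prod.ext_iff.1 hx
        obtain ⟨h3, h4⟩ := Fin.snoc_injective2 (α := fun _ => ZMod 2) h1
        simp_all
      rw [← shannon_comp_injective μ _ he, hE]
      simp only [bitPrefix_succ, Q_eq]
    · simp only [hE, ← Q_eq]
  have e2 : ∀ i : Fin (2 ^ n), weight pairEntropy (informed (blockLaw μ X Y S n i)) =
      F (i + 1) - F i := by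
    intro i
    have : informed (blockLaw μ X Y S n i) = fun u (x : 𝒮 × 𝒮 × Obs 𝒴 n i) =>
        μ.real {ω | U X n i ω = u ∧ (S 0 ω, S (2 ^ n) ω, Q X Y n i ω) = x} := by
      funext u x
      refine congrArg μ.real (Set.ext fun ω => ?_)
      simp only [Set.mem_ofPred_eq, Prod.ext_iff]
      tauto
    rw [this, weight_entropy_eq μ (h.measurable_U n i)]
    congr 1
    · have he : Function.Injective fun x : ZMod 2 × 𝒮 × 𝒮 × Obs 𝒴 n i =>
          (((x.2.1, x.2.2.1) : 𝒮 × 𝒮), (Fin.snoc (α := fun _ => ZMod 2) x.2.2.2.1 x.1 :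
            Fin (i + 1) → ZMod 2), x.2.2.2.2) := by
        rintro ⟨u, a, b, p, y⟩ ⟨u', a', b', p', y'⟩ hx
        obtain ⟨h0, h1⟩ := Prod.ext_iff.1 hx
        obtain ⟨h1, h2⟩ := Prod.ext_iff.1 h1
        obtain ⟨h3, h4⟩ := Fin.snoc_injective2 (α := fun _ => ZMod 2) h1
        simp_all
      rw [← shannon_comp_injective μ _ he, hF]
      simp only [bitPrefix_succ, Q_eq, hs]
    · rw [← shannon_comp_injective μ _ (Equiv.prodAssoc 𝒮 𝒮 (Obs 𝒴 n i)).symm.injective]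
      simp only [hF, ← Q_eq]
      rfl
  have e3 : ∑ i : Fin (2 ^ n), (weight pairEntropy (uninformed (blockLaw μ X Y S n i)) -
      weight pairEntropy (informed (blockLaw μ X Y S n i))) =
      (E (2 ^ n) - E 0) - (F (2 ^ n) - F 0) := by
    simp_rw [e1, e2]
    rw [Finset.sum_sub_distrib, Fin.sum_univ_eq_sum_range (fun k => E (k + 1) - E k),
      Fin.sum_univ_eq_sum_range (fun k => F (k + 1) - F k), Finset.sum_range_sub,
      Finset.sum_range_sub]
  have e4 : E (2 ^ n) ≤ F (2 ^ n) := shannon_le_prodMk μ _ hsm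
  have e5 : F 0 ≤ E 0 + Real.log (Fintype.card (𝒮 × 𝒮)) :=
    shannon_prodMk_le ((measurable_pi_lambda _ fun j => j.elim0).prodMk hYm) hsm
  rw [e3]
  linarith

end IsFAIM

end FAIM

/-! ### Doubly exponential decay along a path -/

/-- The number of times `j < n` at which `b j` takes the value `t`. -/
def countBits (b : ℕ → Bool) (t : Bool) (n : ℕ) : ℕ :=
  ∑ j ∈ Finset.range n, if b j = t then 1 else 0

lemma countBits_succ (b : ℕ → Bool) (t : Bool) (n : ℕ) :
    countBits b t (n + 1) = countBits b t n + if b n = t then 1 else 0 :=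
  Finset.sum_range_succ _ _

lemma countBits_le (b : ℕ → Bool) (t : Bool) (n : ℕ) : countBits b t n ≤ n := by
  induction n with
  | zero => simp [countBits]
  | succ n ih => rw [countBits_succ]; split_ifs <;> omega

section Decay

variable {b : ℕ → Bool} {t : Bool} {l : ℕ → ℝ} {γ : ℝ}

/-- While `l` stays above `τ`, each good step gains `τ`, and each step loses at most `γ`. -/
lemma linear_growth (hγ : ∀ n, l n - γ ≤ l (n + 1)) (hγ' : ∀ n, b n = t → 2 * l n - γ ≤ l (n + 1))
    {τ : ℝ} (hτ : 0 ≤ τ) {m : ℕ} (hm : ∀ k ≥ m, τ ≤ l k) {s : ℕ} (hs : m ≤ s) :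
    τ * ((countBits b t s : ℝ) - countBits b t m) - γ * ((s : ℝ) - m) ≤ l s := by
  induction s, hs using Nat.le_induction with
  | base => simpa using hτ.trans (hm m le_rfl)
  | succ s hs ih =>
    rw [countBits_succ]
    split_ifs with hb
    · have h1 := hγ' s hb
      have h2 := hm s hs
      push_cast
      linarith
    · have h1 := hγ s
      push_cast
      linarith

/-- After reserving the total loss `γ (n - k)` up to the time horizon `n`, what remains of `l`
doubles at each good step. -/
lemma exponential_growth (hγ0 : 0 ≤ γ) (hγ : ∀ n, l n - γ ≤ l (n + 1))
    (hγ' : ∀ n, b n = t → 2 * l n - γ ≤ l (n + 1)) {s n : ℕ} (hs : γ * n + 1 ≤ l s) {k : ℕ}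
    (hsk : s ≤ k) (hkn : k ≤ n) :
    (2 : ℝ) ^ countBits b t k ≤ 2 ^ countBits b t s * (l k - γ * ((n : ℝ) - k)) := by
  induction k, hsk using Nat.le_induction with
  | base =>
    refine le_mul_of_one_le_right (by positivity) ?_
    nlinarith [mul_nonneg hγ0 (Nat.cast_nonneg (α := ℝ) s)]
  | succ k hk ih =>
    have ih := ih (by omega)
    have hp : (0 : ℝ) < 2 ^ countBits b t s := by positivity
    have hkn' : (k : ℝ) ≤ n := by exact_mod_cast (by omega : k ≤ n)
    have h3 := mul_nonneg hγ0 (sub_nonneg.2 hkn')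
    rw [countBits_succ]
    split_ifs with hb
    · have h1 := hγ' k hb
      rw [pow_succ]
      push_cast
      have : 2 * (l k - γ * ((n : ℝ) - k)) ≤ l (k + 1) - γ * ((n : ℝ) - (k + 1)) := by linarith
      nlinarith [mul_le_mul_of_nonneg_left this hp.le]
    · have h1 := hγ k
      push_cast
      have : (l k - γ * ((n : ℝ) - k)) ≤ l (k + 1) - γ * ((n : ℝ) - (k + 1)) := by linarith
      rw [add_zero]
      exact ih.trans (mul_le_mul_of_nonneg_left this hp.le)

/-- If `l` tends to infinity, doubles at good steps up to bounded losses, and half of the steps are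
good, then `l` grows like `2 ^ (β n)` for every `β < 1 / 2`. On an initial segment of length `α n`
the growth is linear with a slope as large as desired; it exceeds the losses incurred until
time `n`, and the remaining steps double the excess. -/
lemma eventually_two_pow_le (hγ0 : 0 ≤ γ) (hγ : ∀ n, l n - γ ≤ l (n + 1))
    (hγ' : ∀ n, b n = t → 2 * l n - γ ≤ l (n + 1)) (hl : Tendsto l atTop atTop)
    (hb : Tendsto (fun n : ℕ => (countBits b t n : ℝ) / n) atTop (𝓝 (1 / 2)))
    {β : ℝ} (hβ0 : 0 < β) (hβ : β < 1 / 2) :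
    ∀ᶠ n : ℕ in atTop, (2 : ℝ) ^ ((n : ℝ) * β) ≤ l n := by
  set α : ℝ := 1 / 2 - β with hα
  have hα0 : 0 < α := by linarith
  set τ : ℝ := 4 * (γ + 2 * (γ + 1) / α) with hτ
  have hτ0 : 0 ≤ τ := by positivity
  obtain ⟨m, hm⟩ := eventually_atTop.1 (hl.eventually_ge_atTop τ)
  -- the end of the initial segment
  set s : ℕ → ℕ := fun n => ⌊α * n⌋₊ with hs
  have hsn : Tendsto (fun n : ℕ => (s n : ℝ) / n) atTop (𝓝 α) :=
    (tendsto_nat_floor_mul_div_atTop hα0.le).comp tendsto_natCast_atTop_atTop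
  have hs_top : Tendsto s atTop atTop := tendsto_nat_floor_atTop.comp
    (Tendsto.const_mul_atTop hα0 tendsto_natCast_atTop_atTop)
  have hcs : Tendsto (fun n : ℕ => (countBits b t (s n) : ℝ) / n) atTop (𝓝 (1 / 2 * α)) := by
    refine ((hb.comp hs_top).mul hsn).congr' ?_
    filter_upwards [hs_top.eventually_gt_atTop 0] with n hn
    have : (s n : ℝ) ≠ 0 := by exact_mod_cast hn.ne'
    simp only [Function.comp]
    field_simp
  have e1 : ∀ᶠ n : ℕ in atTop, β < (countBits b t n : ℝ) / n - (countBits b t (s n) : ℝ) / n :=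
    (hb.sub hcs).eventually_const_lt (by rw [hα]; nlinarith)
  have e2 : ∀ᶠ n : ℕ in atTop, α / 2 < (s n : ℝ) / n := hsn.eventually_const_lt (by linarith)
  have e3 : ∀ᶠ n : ℕ in atTop, 1 / 4 < (countBits b t (s n) : ℝ) / (s n) :=
    hs_top.eventually (hb.eventually_const_lt (by norm_num))
  filter_upwards [e1, e2, e3, eventually_gt_atTop 0, hs_top.eventually_ge_atTop m,
    hs_top.eventually_gt_atTop 0,
    tendsto_natCast_atTop_atTop.eventually_ge_atTop (1 + τ * m)] with n h1 h2 h3 hn hms hs0 hn2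
  have hn0 : (0 : ℝ) < n := by exact_mod_cast hn
  have hs0' : (0 : ℝ) < s n := by exact_mod_cast hs0
  rw [← sub_div, lt_div_iff₀ hn0] at h1
  rw [lt_div_iff₀ hn0] at h2
  rw [lt_div_iff₀ hs0'] at h3
  have hstart : γ * n + 1 ≤ l (s n) := by
    have hg := linear_growth hγ hγ' hτ0 hm hms
    have hcm : (countBits b t m : ℝ) ≤ m := by exact_mod_cast countBits_le b t m
    have h4 : τ * (1 / 4 * s n - m) ≤ τ * ((countBits b t (s n) : ℝ) - countBits b t m) :=
      mul_le_mul_of_nonneg_left (by linarith) hτ0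
    have h5 : (τ / 4 - γ) * (α / 2 * n) ≤ (τ / 4 - γ) * s n :=
      mul_le_mul_of_nonneg_left h2.le (by rw [hτ]; ring_nf; positivity)
    have h6 : (τ / 4 - γ) * (α / 2 * n) = (γ + 1) * n := by rw [hτ]; field_simp; ring
    have h7 : 0 ≤ γ * m := by positivity
    nlinarith
  have hsle : s n ≤ n := by
    have : (s n : ℝ) ≤ α * n := Nat.floor_le (by positivity)
    exact_mod_cast this.trans (mul_le_of_le_one_left hn0.le (by linarith))
  have hexp := exponential_growth hγ0 hγ hγ' hstart hsle le_rfl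
  rw [sub_self, mul_zero, sub_zero] at hexp
  have hp : (0 : ℝ) < 2 ^ countBits b t (s n) := by positivity
  rw [← div_le_iff₀' hp] at hexp
  refine le_trans ?_ hexp
  rw [← Real.rpow_natCast, ← Real.rpow_natCast, ← Real.rpow_sub two_pos]
  exact Real.rpow_le_rpow_of_exponent_le one_le_two (by linarith)

/-- A null sequence that is squared at good steps, up to bounded factors, decays doubly
exponentially if half of the steps are good. -/
lemma eventually_lt_of_squaring {A : ℕ → ℝ} {C : ℝ} (hC : 1 ≤ C) (hA : ∀ n, 0 ≤ A n)
    (hA1 : ∀ n, A n ≤ 1)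
    (h0 : ∀ n, b n ≠ t → A (n + 1) ≤ C * A n) (h1 : ∀ n, b n = t → A (n + 1) ≤ C * A n ^ 2)
    (hlim : Tendsto A atTop (𝓝 0))
    (hb : Tendsto (fun n : ℕ => (countBits b t n : ℝ) / n) atTop (𝓝 (1 / 2)))
    {β : ℝ} (hβ0 : 0 < β) (hβ : β < 1 / 2) :
    ∀ᶠ n : ℕ in atTop, A n < (2 : ℝ) ^ (-(2 : ℝ) ^ ((n : ℝ) * β)) := by
  by_cases hz : ∃ k, A k = 0
  · obtain ⟨k, hk⟩ := hz
    refine eventually_atTop.2 ⟨k, fun n hn => ?_⟩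
    have : A n = 0 := by
      induction n, hn using Nat.le_induction with
      | base => exact hk
      | succ n _ ih =>
        refine le_antisymm ?_ (hA _)
        by_cases hbn : b n = t
        · simpa [ih] using h1 n hbn
        · simpa [ih] using h0 n hbn
    rw [this]
    positivity
  push Not at hz
  have hpos : ∀ n, 0 < A n := fun n => (hA n).lt_of_ne (hz n).symm
  have hC0 : 0 < C := by linarith
  have hlog : ∀ n, Real.log (A n) ≤ 0 := fun n => Real.log_nonpos (hA n) (hA1 n)
  have hlogC : 0 ≤ Real.log C := Real.log_nonneg hC
  have g1 : ∀ n, b n = t → 2 * -Real.log (A n) - Real.log C ≤ -Real.log (A (n + 1)) := by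
    intro n hn
    have := Real.log_le_log (hpos _) (h1 n hn)
    rw [Real.log_mul hC0.ne' (pow_pos (hpos n) 2).ne', Real.log_pow] at this
    push_cast at this
    linarith
  have g0 : ∀ n, -Real.log (A n) - Real.log C ≤ -Real.log (A (n + 1)) := by
    intro n
    by_cases hn : b n = t
    · linarith [g1 n hn, hlog n]
    · have := Real.log_le_log (hpos _) (h0 n hn)
      rw [Real.log_mul hC0.ne' (hpos n).ne'] at this
      linarith
  have htop : Tendsto (fun n => -Real.log (A n)) atTop atTop := by
    refine tendsto_neg_atBot_atTop.comp (Real.tendsto_log_nhdsGT_zero.comp ?_)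
    exact tendsto_nhdsWithin_iff.2 ⟨hlim, Eventually.of_forall hpos⟩
  filter_upwards [eventually_two_pow_le hlogC g0 g1 htop hb hβ0 hβ]
    with n hn
  have hp : (0 : ℝ) < 2 ^ ((n : ℝ) * β) := by positivity
  rw [Real.rpow_def_of_pos two_pos, ← Real.log_lt_iff_lt_exp (hpos n)]
  have h2 : Real.log 2 < 1 := by linarith [Real.log_two_lt_d9]
  nlinarith

end Decay

/-! ### The random path in the polarization tree -/

lemma binaryIndex_succ_val (b : ℕ → Bool) (n : ℕ) :
    (binaryIndex b (n + 1) : ℕ) = 2 * binaryIndex b n + (b n).toNat := by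
  simp only [binaryIndex, Finset.sum_range_succ, Finset.mul_sum, Nat.add_sub_cancel, Nat.sub_self,
    pow_zero, mul_one]
  congr 1
  refine Finset.sum_congr rfl fun j hj => ?_
  have hj' := Finset.mem_range.1 hj
  rw [show n - j = (n - 1 - j) + 1 by omega, pow_succ]
  ring

lemma binaryIndex_succ (b : ℕ → Bool) (n : ℕ) :
    binaryIndex b (n + 1) =
      if b n = true then plusIdx (binaryIndex b n) else minusIdx (binaryIndex b n) := by
  refine Fin.ext ?_
  rw [binaryIndex_succ_val]
  cases b n <;> simp [plusIdx, minusIdx]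

lemma half_binaryIndex (b : ℕ → Bool) (n : ℕ) : half (binaryIndex b (n + 1)) = binaryIndex b n := by
  rw [binaryIndex_succ]; split_ifs <;> simp

lemma binaryIndex_eq_iff (b : ℕ → Bool) (n : ℕ) (i : Fin (2 ^ n)) :
    binaryIndex b n = i ↔ ∀ j ∈ Finset.range n, b j = (i : ℕ).testBit (n - 1 - j) := by
  induction n with
  | zero =>
    refine ⟨fun _ j hj => by simp at hj, fun _ => Fin.ext ?_⟩
    have := i.is_lt
    have := (binaryIndex b 0).is_lt
    omega
  | succ n ih =>
    have h1 : binaryIndex b (n + 1) = i ↔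
        binaryIndex b n = half i ∧ b n = (i : ℕ).testBit 0 := by
      rw [Fin.ext_iff, Fin.ext_iff, binaryIndex_succ_val, half_val, Nat.testBit_zero]
      cases b n <;> simp <;> omega
    rw [h1, ih, Finset.range_add_one, Finset.forall_mem_insert, and_comm]
    refine and_congr (by simp) (forall₂_congr fun j hj => ?_)
    have hj' := Finset.mem_range.1 hj
    rw [half_val, show n + 1 - 1 - j = (n - 1 - j) + 1 by omega, Nat.testBit_succ]

/-- A sum over the nodes of a level, grouped by parents. -/
lemma sum_children {n : ℕ} (f : Fin (2 ^ (n + 1)) → ℝ) :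
    ∑ k, f k = ∑ i : Fin (2 ^ n), (f (minusIdx i) + f (plusIdx i)) := by
  rw [← Finset.sum_fiberwise Finset.univ half f]
  refine Finset.sum_congr rfl fun i _ => ?_
  have hne : minusIdx i ≠ plusIdx i := fun h => by
    have := congrArg Fin.val h
    simp [minusIdx, plusIdx] at this
  rw [← Finset.sum_pair hne]
  refine Finset.sum_congr (Finset.ext fun k => ?_) fun _ _ => rfl
  simp only [Finset.mem_filter, Finset.mem_univ, true_and, Finset.mem_insert,
    Finset.mem_singleton, Fin.ext_iff, half_val, minusIdx, plusIdx]
  omega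

section Bits

variable {Ω' : Type*} [MeasurableSpace Ω'] {P : Measure Ω'} [IsProbabilityMeasure P]
  {B : ℕ → Ω' → Bool}

lemma measurable_binaryIndex (hB : ∀ j, Measurable (B j)) (n : ℕ) :
    Measurable fun ω => binaryIndex (fun j => B j ω) n := by
  refine measurable_to_countable' fun i => ?_
  have : (fun ω => binaryIndex (fun j => B j ω) n) ⁻¹' {i} =
      ⋂ j ∈ Finset.range n, B j ⁻¹' {(i : ℕ).testBit (n - 1 - j)} := by
    ext ω
    simp only [Set.mem_preimage, Set.mem_singleton_iff, binaryIndex_eq_iff, Set.mem_iInter]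
  rw [this]
  exact Finset.measurableSet_biInter _ fun j _ => hB j (measurableSet_singleton _)

lemma measure_bit (hB : ∀ j, Measurable (B j)) (hhalf : ∀ j, P {ω | B j ω = true} = 1 / 2) (j : ℕ)
    (t : Bool) : P (B j ⁻¹' {t}) = 1 / 2 := by
  cases t
  · have : B j ⁻¹' {false} = {ω | B j ω = true}ᶜ := by ext ω; simp
    rw [this, prob_compl_eq_one_sub (show MeasurableSet {ω | B j ω = true} from
      hB j (measurableSet_singleton true)), hhalf]
    simp
  · exact hhalf j

lemma integrable_binaryIndex (hB : ∀ j, Measurable (B j)) (n : ℕ) (g : Fin (2 ^ n) → ℝ) :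
    Integrable (fun ω => g (binaryIndex (fun j => B j ω) n)) P :=
  (Integrable.of_finite (μ := P.map fun ω => binaryIndex (fun j => B j ω) n)
    (f := g)).comp_measurable (measurable_binaryIndex hB n)

/-- The index of the node at level `n` is uniformly distributed. -/
lemma integral_binaryIndex (hB : ∀ j, Measurable (B j)) (hind : iIndepFun B P)
    (hhalf : ∀ j, P {ω | B j ω = true} = 1 / 2) (n : ℕ) (f : Fin (2 ^ n) → ℝ) :
    ∫ ω, f (binaryIndex (fun j => B j ω) n) ∂P = (2 ^ n)⁻¹ * ∑ i, f i := by
  have hm := measurable_binaryIndex hB n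
  rw [← integral_map (f := f) hm.aemeasurable (measurable_of_finite f).aestronglyMeasurable]
  have := Measure.isProbabilityMeasure_map (μ := P) hm.aemeasurable
  rw [integral_fintype Integrable.of_finite, Finset.mul_sum]
  refine Finset.sum_congr rfl fun i _ => ?_
  rw [measureReal_def, Measure.map_apply hm (measurableSet_singleton i)]
  have : (fun ω => binaryIndex (fun j => B j ω) n) ⁻¹' {i} =
      ⋂ j ∈ Finset.range n, B j ⁻¹' {(i : ℕ).testBit (n - 1 - j)} := by
    ext ω
    simp only [Set.mem_preimage, Set.mem_singleton_iff, binaryIndex_eq_iff, Set.mem_iInter]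
  rw [this, hind.measure_inter_preimage_eq_mul (Finset.range n)
    (sets := fun j => {(i : ℕ).testBit (n - 1 - j)}) fun j _ => measurableSet_singleton _]
  simp_rw [measure_bit hB hhalf]
  simp

/-- The law of large numbers for the selecting bits. -/
lemma ae_tendsto_countBits (hB : ∀ j, Measurable (B j)) (hind : iIndepFun B P)
    (hhalf : ∀ j, P {ω | B j ω = true} = 1 / 2) (t : Bool) :
    ∀ᵐ ω ∂P, Tendsto (fun n : ℕ => (countBits (fun j => B j ω) t n : ℝ) / n) atTop
      (𝓝 (1 / 2)) := by
  set g : Bool → ℝ := fun x => if x = t then 1 else 0 with hg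
  have hgm : Measurable g := measurable_of_finite g
  have hid : ∀ j, IdentDistrib (B j) (B 0) P P := fun j =>
    ⟨(hB j).aemeasurable, (hB 0).aemeasurable, by
      refine Measure.ext_of_singleton fun x => ?_
      rw [Measure.map_apply (hB j) (measurableSet_singleton x),
        Measure.map_apply (hB 0) (measurableSet_singleton x), measure_bit hB hhalf,
        measure_bit hB hhalf]⟩
  have hint : Integrable (g ∘ B 0) P :=
    (Integrable.of_finite (μ := P.map (B 0)) (f := g)).comp_measurable (hB 0)
  have hE : ∫ ω, g (B 0 ω) ∂P = 1 / 2 := by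
    have : (fun ω => g (B 0 ω)) = (B 0 ⁻¹' {t}).indicator 1 := by
      ext ω
      by_cases hω : B 0 ω = t <;> simp [hg, hω]
    rw [this, integral_indicator_one (hB 0 (measurableSet_singleton t)), measureReal_def,
      measure_bit hB hhalf]
    simp
  have := strong_law_ae_real (fun j => g ∘ B j) hint
    (fun i j hij => (hind.indepFun hij).comp hgm hgm) fun j => (hid j).comp hgm
  filter_upwards [this] with ω hω
  simp only [Function.comp] at hω
  rw [hE] at hω
  refine hω.congr fun n => ?_
  simp [countBits, hg]

/-- The filtration generated by the path in the polarization tree. -/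
def pathFiltration (hB : ∀ j, Measurable (B j)) :
    Filtration ℕ (inferInstance : MeasurableSpace Ω') where
  seq n := MeasurableSpace.comap (fun ω => binaryIndex (fun j => B j ω) n) ⊤
  mono' := by
    refine monotone_nat_of_le_succ fun n => ?_
    rintro _ ⟨T, -, rfl⟩
    refine ⟨half ⁻¹' T, trivial, ?_⟩
    ext ω
    simp only [Set.mem_preimage, half_binaryIndex]
  le' n := by
    rintro _ ⟨T, -, rfl⟩
    exact measurable_binaryIndex hB n (Set.toFinite T).measurableSet

/-- A function on the polarization tree that is subharmonic with respect to the fair choice between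
the two children is a submartingale along the random path. -/
lemma submartingale_path (hB : ∀ j, Measurable (B j)) (hind : iIndepFun B P)
    (hhalf : ∀ j, P {ω | B j ω = true} = 1 / 2) (f : (n : ℕ) → Fin (2 ^ n) → ℝ)
    (hf : ∀ n i, 2 * f n i ≤ f (n + 1) (minusIdx i) + f (n + 1) (plusIdx i)) :
    Submartingale (fun n ω => f n (binaryIndex (fun j => B j ω) n)) (pathFiltration hB) P := by
  refine submartingale_of_setIntegral_le_succ (fun n => ?_)
    (fun n => integrable_binaryIndex hB n _) fun n s hs => ?_
  · have h1 : Measurable[pathFiltration hB n, ⊤] fun ω => binaryIndex (fun j => B j ω) n :=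
      comap_measurable _
    exact ((measurable_from_top (f := f n)).comp h1).stronglyMeasurable
  · obtain ⟨T, -, rfl⟩ := hs
    have hT : MeasurableSet ((fun ω => binaryIndex (fun j => B j ω) n) ⁻¹' T) :=
      measurable_binaryIndex hB n (Set.toFinite T).measurableSet
    rw [← integral_indicator hT, ← integral_indicator hT]
    classical
    have e1 : ∀ ω, ((fun ω => binaryIndex (fun j => B j ω) n) ⁻¹' T).indicator
        (fun ω => f n (binaryIndex (fun j => B j ω) n)) ω =
        T.indicator (f n) (binaryIndex (fun j => B j ω) n) := fun ω => rfl
    have e2 : ∀ ω, ((fun ω => binaryIndex (fun j => B j ω) n) ⁻¹' T).indicator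
        (fun ω => f (n + 1) (binaryIndex (fun j => B j ω) (n + 1))) ω =
        (half ⁻¹' T).indicator (f (n + 1)) (binaryIndex (fun j => B j ω) (n + 1)) := fun ω => by
      simp only [Set.indicator_apply, Set.mem_preimage, half_binaryIndex]
    simp_rw [e1, e2]
    rw [integral_binaryIndex hB hind hhalf, integral_binaryIndex hB hind hhalf, sum_children,
      pow_succ, mul_inv, mul_assoc]
    refine mul_le_mul_of_nonneg_left ?_ (by positivity)
    rw [Finset.mul_sum]
    refine Finset.sum_le_sum fun i _ => ?_
    simp only [Set.indicator_apply, Set.mem_preimage, half_minusIdx, half_plusIdx]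
    split_ifs
    · linarith [hf n i]
    · simp

/-- A nonnegative function on the polarization tree whose level sums are bounded vanishes in the
limit along almost every path. -/
lemma ae_tendsto_zero_of_sum_le (hB : ∀ j, Measurable (B j)) (hind : iIndepFun B P)
    (hhalf : ∀ j, P {ω | B j ω = true} = 1 / 2) (f : (n : ℕ) → Fin (2 ^ n) → ℝ)
    (hf : ∀ n i, 0 ≤ f n i) {L : ℝ} (hL : ∀ n, ∑ i, f n i ≤ L) :
    ∀ᵐ ω ∂P, Tendsto (fun n => f n (binaryIndex (fun j => B j ω) n)) atTop (𝓝 0) := by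
  have hm : ∀ n, Measurable fun ω => f n (binaryIndex (fun j => B j ω) n) := fun n =>
    (measurable_of_finite (f n)).comp (measurable_binaryIndex hB n)
  have hint : ∀ n, ∫⁻ ω, ENNReal.ofReal (f n (binaryIndex (fun j => B j ω) n)) ∂P ≤
      ENNReal.ofReal (L * (1 / 2) ^ n) := by
    intro n
    rw [← ofReal_integral_eq_lintegral_ofReal (integrable_binaryIndex hB n (f n))
      (Eventually.of_forall fun ω => hf n _), integral_binaryIndex hB hind hhalf]
    refine ENNReal.ofReal_le_ofReal ?_
    rw [mul_comm, one_div, inv_pow]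
    exact mul_le_mul_of_nonneg_right (hL n) (by positivity)
  have hL0 : 0 ≤ L := (Finset.sum_nonneg fun i _ => hf 0 i).trans (hL 0)
  have hsum : ∫⁻ ω, ∑' n, ENNReal.ofReal (f n (binaryIndex (fun j => B j ω) n)) ∂P ≠ ⊤ := by
    rw [lintegral_tsum fun n => (hm n).ennreal_ofReal.aemeasurable]
    refine ne_top_of_le_ne_top ?_ (ENNReal.tsum_le_tsum hint)
    rw [← ENNReal.ofReal_tsum_of_nonneg (fun n => by positivity)
      (summable_geometric_two.mul_left L)]
    exact ENNReal.ofReal_ne_top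
  filter_upwards [ae_lt_top (Measurable.tsum fun n => (hm n).ennreal_ofReal) hsum]
    with ω hω
  have := ENNReal.tendsto_atTop_zero_of_tsum_ne_top hω.ne
  have := (ENNReal.tendsto_toReal ENNReal.zero_ne_top).comp this
  simpa [Function.comp_def, ENNReal.toReal_ofReal (hf _ _)] using this

/-- A bounded subharmonic function `f` on the polarization tree converges along almost every path,
and if its increments to the minus children dominate `g ∘ f` for a nonnegative continuous
function `g`, then the limit is a zero of `g`. -/
lemma ae_tendsto_path (hB : ∀ j, Measurable (B j)) (hind : iIndepFun B P)
    (hhalf : ∀ j, P {ω | B j ω = true} = 1 / 2) (f : (n : ℕ) → Fin (2 ^ n) → ℝ)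
    (hf : ∀ n i, 2 * f n i ≤ f (n + 1) (minusIdx i) + f (n + 1) (plusIdx i)) {M : ℝ}
    (hf0 : ∀ n i, f n i ∈ Set.Icc 0 M) {g : ℝ → ℝ} (hg : Continuous g)
    (hg0 : ∀ x ∈ Set.Icc 0 M, 0 ≤ g x)
    (hgap : ∀ᶠ n in atTop, ∀ i, g (f n i) ≤ f (n + 1) (minusIdx i) - f n i) :
    ∃ F : Ω' → ℝ, Measurable F ∧ ∀ᵐ ω ∂P,
      Tendsto (fun n => f n (binaryIndex (fun j => B j ω) n)) atTop (𝓝 (F ω)) ∧ g (F ω) = 0 := by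
  set Z : ℕ → Ω' → ℝ := fun n ω => f n (binaryIndex (fun j => B j ω) n) with hZ
  have hZm : ∀ n, Measurable (Z n) := fun n =>
    (measurable_of_finite (f n)).comp (measurable_binaryIndex hB n)
  have hM : ∀ n ω, ‖Z n ω‖ ≤ M := fun n ω => by
    rw [Real.norm_of_nonneg (hf0 n _).1]; exact (hf0 n _).2
  have hsub := submartingale_path hB hind hhalf f hf
  set F : Ω' → ℝ := Filtration.limitProcess Z (pathFiltration hB) P with hF
  have hFm : Measurable F := Filtration.stronglyMeasurable_limit_process'.measurable
  have hlim : ∀ᵐ ω ∂P, Tendsto (fun n => Z n ω) atTop (𝓝 (F ω)) := by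
    refine hsub.ae_tendsto_limitProcess (R := M.toNNReal) fun n => ?_
    refine (eLpNorm_le_of_ae_bound (C := M) (Eventually.of_forall (hM n))).trans ?_
    simp [ENNReal.ofReal]
  refine ⟨F, hFm, ?_⟩
  have hFI : ∀ᵐ ω ∂P, F ω ∈ Set.Icc 0 M := by
    filter_upwards [hlim] with ω hω
    exact isClosed_Icc.mem_of_tendsto hω (Eventually.of_forall fun n => hf0 n _)
  -- the increments tend to zero in mean
  have hinc : Tendsto (fun n => ∫ ω, |Z (n + 1) ω - Z n ω| ∂P) atTop (𝓝 0) := by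
    have h0 : ∫ _ω, (0 : ℝ) ∂P = 0 := by simp
    rw [← h0]
    refine tendsto_integral_of_dominated_convergence (fun _ => M + M)
      (fun n => ((hZm (n + 1)).sub (hZm n)).abs.aestronglyMeasurable) (integrable_const _)
      (fun n => Eventually.of_forall fun ω => ?_) ?_
    · rw [Real.norm_eq_abs, abs_abs]
      exact (norm_sub_le _ _).trans (add_le_add (hM _ _) (hM _ _))
    · filter_upwards [hlim] with ω hω
      have := ((hω.comp (tendsto_add_atTop_nat 1)).sub hω).abs
      simpa [Function.comp_def] using this
  obtain ⟨K, hK⟩ := (isCompact_Icc (a := (0 : ℝ)) (b := M)).exists_bound_of_continuousOn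
    hg.continuousOn
  have hgZ : Tendsto (fun n => ∫ ω, g (Z n ω) ∂P) atTop (𝓝 (∫ ω, g (F ω) ∂P)) := by
    refine tendsto_integral_of_dominated_convergence (fun _ => K)
      (fun n => (hg.measurable.comp (hZm n)).aestronglyMeasurable) (integrable_const _)
      (fun n => Eventually.of_forall fun ω => hK _ (hf0 n _)) ?_
    filter_upwards [hlim] with ω hω
    exact (hg.tendsto _).comp hω
  have hle : ∀ᶠ n in atTop, ∫ ω, g (Z n ω) ∂P ≤ 2 * ∫ ω, |Z (n + 1) ω - Z n ω| ∂P := by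
    filter_upwards [hgap] with n hn
    have e1 : ∫ ω, g (Z n ω) ∂P = (2 ^ n)⁻¹ * ∑ i, g (f n i) :=
      integral_binaryIndex hB hind hhalf n fun i => g (f n i)
    have e2 : ∫ ω, |Z (n + 1) ω - Z n ω| ∂P =
        (2 ^ (n + 1))⁻¹ * ∑ k, |f (n + 1) k - f n (half k)| := by
      rw [← integral_binaryIndex hB hind hhalf]
      simp only [hZ, half_binaryIndex]
    rw [e1, e2, sum_children, pow_succ, mul_inv, ← mul_assoc, mul_comm 2, mul_assoc, mul_assoc,
      inv_mul_cancel_left₀ two_ne_zero]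
    refine mul_le_mul_of_nonneg_left (Finset.sum_le_sum fun i _ => ?_) (by positivity)
    rw [half_minusIdx]
    linarith [hn i, le_abs_self (f (n + 1) (minusIdx i) - f n i),
      abs_nonneg (f (n + 1) (plusIdx i) - f n (half (plusIdx i)))]
  have hzero : ∫ ω, g (F ω) ∂P = 0 := by
    refine le_antisymm ?_ (integral_nonneg_of_ae ?_)
    · have := le_of_tendsto_of_tendsto hgZ (hinc.const_mul 2) hle
      simpa using this
    · filter_upwards [hFI] with ω hω using hg0 _ hω
  have hae := (integral_eq_zero_iff_of_nonneg_ae (by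
    filter_upwards [hFI] with ω hω using hg0 _ hω) (by
      refine Integrable.of_bound (hg.measurable.comp hFm).aestronglyMeasurable K ?_
      filter_upwards [hFI] with ω hω using hK _ hω)).1 hzero
  filter_upwards [hlim, hae] with ω h1 h2
  exact ⟨h1, h2⟩

end Bits

/-! ### Polarization of FAIM processes -/

namespace IsFAIM

variable {Ω 𝒴 𝒮 : Type*} [MeasurableSpace Ω] [Fintype 𝒴] [MeasurableSpace 𝒴]
  [MeasurableSingletonClass 𝒴] [Fintype 𝒮] [MeasurableSpace 𝒮] [MeasurableSingletonClass 𝒮]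
  {μ : Measure Ω} [IsProbabilityMeasure μ] {X : ℤ → Ω → ZMod 2} {Y : ℤ → Ω → 𝒴} {S : ℤ → Ω → 𝒮}
  (h : IsFAIM μ X Y S)

include h

/-- The recursion of the Bhattacharyya parameter without boundary states. -/
lemma exists_bhat_recursion : ∃ C : ℝ, 1 ≤ C ∧ ∀ n (i : Fin (2 ^ n)),
    weight pairBhat (uninformed (blockLaw μ X Y S (n + 1) (minusIdx i))) ≤
      C * weight pairBhat (uninformed (blockLaw μ X Y S n i)) ∧
    weight pairBhat (uninformed (blockLaw μ X Y S (n + 1) (plusIdx i))) ≤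
      C * weight pairBhat (uninformed (blockLaw μ X Y S n i)) ^ 2 := by
  set ψ : ℝ := ∑ a, (stateLaw μ S a)⁻¹ with hψ
  have hψ0 : 0 ≤ ψ := Finset.sum_nonneg fun a _ => (inv_pos.2 (h.stateLaw_pos a)).le
  have h0 : pairBhat 0 0 = 0 := by simp [pairBhat]
  refine ⟨2 * ψ + 1, by linarith, fun n i => ⟨?_, ?_⟩⟩
  · rw [(h.isRelabelling_minus n i).weight_uninformed h0]
    refine ((h.isBlockLaw n i).bhat_minus_le h.inv_stateLaw_le hψ0).trans ?_
    exact mul_le_mul_of_nonneg_right (by linarith) (weight_bhat_nonneg _)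
  · rw [(h.isRelabelling_plus n i).weight_uninformed h0]
    refine ((h.isBlockLaw n i).bhat_plus_le h.inv_stateLaw_le hψ0).trans ?_
    exact mul_le_mul_of_nonneg_right (by linarith) (sq_nonneg _)

/-- The recursion of the total variation with boundary states, where minus and plus steps have
exchanged their roles. -/
lemma exists_dist_recursion : ∃ C : ℝ, 1 ≤ C ∧ ∀ n (i : Fin (2 ^ n)),
    weight pairDist (informed (blockLaw μ X Y S (n + 1) (minusIdx i))) ≤
      C * weight pairDist (informed (blockLaw μ X Y S n i)) ^ 2 ∧
    weight pairDist (informed (blockLaw μ X Y S (n + 1) (plusIdx i))) ≤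
      C * weight pairDist (informed (blockLaw μ X Y S n i)) := by
  set ψ : ℝ := ∑ a, (stateLaw μ S a)⁻¹ with hψ
  have hψ0 : 0 ≤ ψ := Finset.sum_nonneg fun a _ => (inv_pos.2 (h.stateLaw_pos a)).le
  have h0 : pairDist 0 0 = 0 := by simp [pairDist]
  refine ⟨ψ + 2, by linarith, fun n i => ⟨?_, ?_⟩⟩
  · rw [(h.isRelabelling_minus n i).weight_informed h0]
    refine ((h.isBlockLaw n i).dist_minus_le h.inv_stateLaw_le).trans ?_
    exact mul_le_mul_of_nonneg_right (by linarith) (sq_nonneg _)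
  · rw [(h.isRelabelling_plus n i).weight_informed h0]
    refine (h.isBlockLaw n i).dist_plus_le.trans ?_
    exact mul_le_mul_of_nonneg_right (by linarith) (weight_dist_nonneg _)

lemma entropy_children_ge (n : ℕ) (i : Fin (2 ^ n)) :
    2 * weight pairEntropy (informed (blockLaw μ X Y S n i)) ≤
      weight pairEntropy (informed (blockLaw μ X Y S (n + 1) (minusIdx i))) +
      weight pairEntropy (informed (blockLaw μ X Y S (n + 1) (plusIdx i))) := by
  have h0 : pairEntropy 0 0 = 0 := by simp [pairEntropy]
  rw [(h.isRelabelling_minus n i).weight_informed h0, (h.isRelabelling_plus n i).weight_informed h0]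
  exact (h.isBlockLaw n i).entropy_step_ge

/-- For long blocks, a minus step increases the entropy unless it is close to an extreme value. -/
lemma exists_entropy_gap : ∃ c > 0, ∀ᶠ n in atTop, ∀ i : Fin (2 ^ n),
    c * ((weight pairEntropy (informed (blockLaw μ X Y S n i)) / 2) ^ 2 *
      (Real.log 2 - weight pairEntropy (informed (blockLaw μ X Y S n i)))) ≤
    weight pairEntropy (informed (blockLaw μ X Y S (n + 1) (minusIdx i))) -
      weight pairEntropy (informed (blockLaw μ X Y S n i)) := by
  have h0 : pairEntropy 0 0 = 0 := by simp [pairEntropy]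
  obtain ⟨κ, hκ, hev⟩ := h.exists_le_statePair
  have hc : (0 : ℝ) < Fintype.card 𝒮 := by
    obtain ⟨ω⟩ := nonempty_of_isProbabilityMeasure μ
    exact_mod_cast Fintype.card_pos_iff.2 ⟨S 0 ω⟩
  refine ⟨κ / (4 * Fintype.card 𝒮), by positivity, ?_⟩
  filter_upwards [(tendsto_pow_atTop_atTop_of_one_lt one_lt_two).eventually hev] with n hn i
  rw [(h.isRelabelling_minus n i).weight_informed h0]
  refine le_trans (mul_le_mul_of_nonneg_left
    (h.isBlockLaw n i).isLaw_informed.entropy_sq_mul_deficit_le (by positivity)) ?_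
  refine (h.isBlockLaw n i).entropy_minus_gap fun a b => ?_
  rw [h.sum_blockLaw]
  simpa using hn a b

variable {Ω' : Type*} [MeasurableSpace Ω'] {P : Measure Ω'} [IsProbabilityMeasure P]
  {B : ℕ → Ω' → Bool}

/-- Almost every path has a limit `0` or `1` of the Bhattacharyya process, and the convergence
is doubly exponentially fast. -/
lemma exists_fast_limit (hB : ∀ j, Measurable (B j)) (hind : iIndepFun B P)
    (hhalf : ∀ j, P {ω | B j ω = true} = 1 / 2) {β : ℝ} (hβ0 : 0 < β) (hβ : β < 1 / 2) :
    ∃ A : Ω' → ℝ, Measurable A ∧ (∀ ω, A ω = 0 ∨ A ω = 1) ∧ ∀ᵐ ω ∂P,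
      Tendsto (fun n => ZHat μ X Y S B n ω) atTop (𝓝 (A ω)) ∧
      (A ω = 0 → ∀ᶠ n : ℕ in atTop,
        ZHat μ X Y S B n ω < (2 : ℝ) ^ (-(2 : ℝ) ^ ((n : ℝ) * β))) ∧
      (A ω = 1 → ∀ᶠ n : ℕ in atTop,
        ZHat μ X Y S B n ω > 1 - (2 : ℝ) ^ (-(2 : ℝ) ^ ((n : ℝ) * β))) := by
  have hinf := fun n (i : Fin (2 ^ n)) => (h.isBlockLaw n i).isLaw_informed
  have hun := fun n (i : Fin (2 ^ n)) => (h.isBlockLaw n i).isLaw_uninformed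
  obtain ⟨c, hc, hgap⟩ := h.exists_entropy_gap
  obtain ⟨C, hC, hrec⟩ := h.exists_bhat_recursion
  obtain ⟨D, hD, hrec'⟩ := h.exists_dist_recursion
  have hlog : 0 < Real.log 2 := Real.log_pos one_lt_two
  obtain ⟨F, hFm, hF⟩ := ae_tendsto_path hB hind hhalf
    (fun n i => weight pairEntropy (informed (blockLaw μ X Y S n i))) h.entropy_children_ge
    (M := Real.log 2) (fun n i => ⟨(hinf n i).entropy_nonneg, (hinf n i).entropy_le_log_two⟩)
    (g := fun x => c * ((x / 2) ^ 2 * (Real.log 2 - x))) (by fun_prop)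
    (fun x hx => mul_nonneg hc.le (mul_nonneg (sq_nonneg _) (sub_nonneg.2 hx.2))) hgap
  have hdiff := ae_tendsto_zero_of_sum_le hB hind hhalf
    (fun n i => weight pairEntropy (uninformed (blockLaw μ X Y S n i)) -
      weight pairEntropy (informed (blockLaw μ X Y S n i)))
    (fun n i => sub_nonneg.2 ((h.isBlockLaw n i).informed_le_uninformed
      fun hf hg => pairEntropy_sum_le Finset.univ hf hg)) h.sum_entropy_sub_le
  classical
  refine ⟨fun ω => if F ω = Real.log 2 then 1 else 0,
    Measurable.ite (hFm (measurableSet_singleton _)) measurable_const measurable_const,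
    fun ω => by dsimp only; split_ifs <;> simp, ?_⟩
  filter_upwards [hF, hdiff, ae_tendsto_countBits hB hind hhalf true,
    ae_tendsto_countBits hB hind hhalf false] with ω hω hω' hct hcf
  obtain ⟨hlim, hzero⟩ := hω
  set i : (n : ℕ) → Fin (2 ^ n) := fun n => binaryIndex (fun j => B j ω) n with hi
  have hi1 : ∀ n, B n ω = true → i (n + 1) = plusIdx (i n) := fun n hn => by
    rw [hi]; simp only [binaryIndex_succ, hn, if_true]
  have hi0 : ∀ n, B n ω = false → i (n + 1) = minusIdx (i n) := fun n hn => by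
    rw [hi]; simp only [binaryIndex_succ, hn, Bool.false_eq_true, if_false]
  have hZ : ∀ n, ZHat μ X Y S B n ω = weight pairBhat (informed (blockLaw μ X Y S n (i n))) :=
    fun n => h.bhattacharyyaBSI_eq n (i n)
  simp only [hZ]
  by_cases hFω : F ω = Real.log 2
  · -- the total variation decays
    rw [if_pos hFω]
    have hdist : Tendsto (fun n => weight pairDist (informed (blockLaw μ X Y S n (i n)))) atTop
        (𝓝 0) := by
      have hsq : Tendsto (fun n => √(2 * (Real.log 2 -
          weight pairEntropy (informed (blockLaw μ X Y S n (i n)))))) atTop (𝓝 0) := by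
        have := ((hlim.const_sub (Real.log 2)).const_mul 2).sqrt
        simpa [hFω] using this
      refine squeeze_zero (fun n => weight_dist_nonneg _) (fun n => ?_) hsq
      exact Real.le_sqrt_of_sq_le ((hinf n (i n)).dist_sq_le.trans
        (hinf n (i n)).sqDist_le_entropy_deficit)
    have hfast := eventually_lt_of_squaring (b := fun j => B j ω) (t := false) hD
      (fun n => weight_dist_nonneg (informed (blockLaw μ X Y S n (i n))))
      (fun n => (hinf n (i n)).dist_le_one)
      (fun n hn => by rw [hi1 n (by simpa using hn)]; exact (hrec' n (i n)).2)
      (fun n hn => by rw [hi0 n hn]; exact (hrec' n (i n)).1) hdist hcf hβ0 hβ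
    refine ⟨?_, fun h10 => absurd h10 one_ne_zero, fun _ => ?_⟩
    · refine tendsto_of_tendsto_of_tendsto_of_le_of_le (by simpa using hdist.const_sub 1)
        tendsto_const_nhds (fun n => (hinf n (i n)).one_sub_dist_le_bhat)
        fun n => (hinf n (i n)).bhat_le_one
    · filter_upwards [hfast] with n hn
      linarith [(hinf n (i n)).one_sub_dist_le_bhat]
  · -- the entropy tends to zero, and so does the one without boundary states
    rw [if_neg hFω]
    have hF0 : F ω = 0 := by
      rcases mul_eq_zero.1 hzero with h1 | h1
      · exact absurd h1 hc.ne'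
      rcases mul_eq_zero.1 h1 with h2 | h2
      · have := pow_eq_zero_iff two_ne_zero |>.1 h2
        linarith
      · exact absurd (sub_eq_zero.1 h2).symm hFω
    have hent : Tendsto (fun n => weight pairEntropy (uninformed (blockLaw μ X Y S n (i n)))) atTop
        (𝓝 0) := by
      have := hω'.add hlim
      simpa [hF0] using this
    have hbhat : Tendsto (fun n => weight pairBhat (uninformed (blockLaw μ X Y S n (i n)))) atTop
        (𝓝 0) := by
      have hsq : Tendsto (fun n => √(2 *
          weight pairEntropy (uninformed (blockLaw μ X Y S n (i n))))) atTop (𝓝 0) := by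
        simpa using (hent.const_mul 2).sqrt
      refine squeeze_zero (fun n => weight_bhat_nonneg _) (fun n => ?_) hsq
      exact Real.le_sqrt_of_sq_le ((hun n (i n)).bhat_sq_le.trans (hun n (i n)).sqBhat_le_entropy)
    have hle : ∀ n, weight pairBhat (informed (blockLaw μ X Y S n (i n))) ≤
        weight pairBhat (uninformed (blockLaw μ X Y S n (i n))) := fun n =>
      (h.isBlockLaw n (i n)).informed_le_uninformed fun hf hg => pairBhat_sum_le Finset.univ hf hg
    have hfast := eventually_lt_of_squaring (b := fun j => B j ω) (t := true) hC
      (fun n => weight_bhat_nonneg (uninformed (blockLaw μ X Y S n (i n))))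
      (fun n => (hun n (i n)).bhat_le_one)
      (fun n hn => by rw [hi0 n (by simpa using hn)]; exact (hrec n (i n)).1)
      (fun n hn => by rw [hi1 n hn]; exact (hrec n (i n)).2) hbhat hct hβ0 hβ
    refine ⟨squeeze_zero (fun n => weight_bhat_nonneg _) hle hbhat, fun _ => ?_,
      fun h01 => absurd h01 zero_ne_one⟩
    filter_upwards [hfast] with n hn using (hle n).trans_lt hn

end IsFAIM

end Polar

theorem mainTheorem5 {Ω Ω' 𝒴 𝒮 : Type*} [MeasurableSpace Ω] [MeasurableSpace Ω']
    [Fintype 𝒴] [MeasurableSpace 𝒴] [MeasurableSingletonClass 𝒴]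
    [Fintype 𝒮] [MeasurableSpace 𝒮] [MeasurableSingletonClass 𝒮]
    (μ : Measure Ω) [IsProbabilityMeasure μ] (P : Measure Ω') [IsProbabilityMeasure P]
    (X : ℤ → Ω → ZMod 2) (Y : ℤ → Ω → 𝒴) (S : ℤ → Ω → 𝒮) (hXYS : Polar.IsFAIM μ X Y S)
    (B : ℕ → Ω' → Bool) (hB_meas : ∀ j, Measurable (B j)) (hB_indep : iIndepFun B P)
    (hB_half : ∀ j, P {ω' | B j ω' = true} = 1 / 2)
    (β : ℝ) (hβ_pos : 0 < β) (hβ : β < 1 / 2) :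
    Polar.PolarizesFastToZero P (Polar.ZHat μ X Y S B) β ∧
      Polar.PolarizesFastToOne P (Polar.ZHat μ X Y S B) β := by
  obtain ⟨A, hAm, hA, hlim⟩ := hXYS.exists_fast_limit hB_meas hB_indep hB_half hβ_pos hβ
  have hZm : ∀ n, Measurable (Polar.ZHat μ X Y S B n) := fun n =>
    (measurable_of_finite fun i : Fin (2 ^ n) =>
      Polar.bhattacharyyaBSI μ (Polar.U X n i) (Polar.Q X Y n i) (S 0) (S (2 ^ n))).comp
      (Polar.measurable_binaryIndex hB_meas n)
  have hZ : ∀ n ω, Polar.ZHat μ X Y S B n ω ∈ Set.Icc (0 : ℝ) 1 := fun n ω => by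
    have h1 := hXYS.bhattacharyyaBSI_eq n (Polar.binaryIndex (fun j => B j ω) n)
    have h2 := (hXYS.isBlockLaw n (Polar.binaryIndex (fun j => B j ω) n)).isLaw_informed
    change Polar.bhattacharyyaBSI _ _ _ _ _ ∈ _
    rw [h1]
    exact ⟨Polar.weight_bhat_nonneg _, h2.bhat_le_one⟩
  have hpol : Polar.PolarizesTo P (Polar.ZHat μ X Y S B) A :=
    ⟨hZm, hZ, hAm, hA, hlim.mono fun ω hω => hω.1⟩
  -- the thresholds stay away from the wrong limit
  have hthr : ∀ n : ℕ, (2 : ℝ) ^ (-(2 : ℝ) ^ ((n : ℝ) * β)) ≤ 1 / 2 := fun n => by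
    have h1 : (1 : ℝ) ≤ 2 ^ ((n : ℝ) * β) := Real.one_le_rpow one_le_two (by positivity)
    calc (2 : ℝ) ^ (-(2 : ℝ) ^ ((n : ℝ) * β)) ≤ 2 ^ (-1 : ℝ) :=
          Real.rpow_le_rpow_of_exponent_le one_le_two (by linarith)
      _ = 1 / 2 := by rw [Real.rpow_neg_one]; norm_num
  have hconv : ∀ {E : ℕ → Set Ω'} {E₀ : Set Ω'}, (∀ n, MeasurableSet (E n)) →
      MeasurableSet E₀ → (∀ᵐ ω ∂P, ∀ᶠ n in atTop, ω ∈ E n ↔ ω ∈ E₀) →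
      Tendsto (fun n => P.real (E n)) atTop (𝓝 (P.real E₀)) := fun hE hE₀ hev =>
    (ENNReal.tendsto_toReal (measure_ne_top P _)).comp
      (tendsto_measure_of_ae_tendsto_indicator_of_isFiniteMeasure atTop hE₀ hE hev)
  refine ⟨⟨A, hpol, hconv (fun n => measurableSet_lt (hZm n) measurable_const)
    (hAm (measurableSet_singleton 0)) ?_⟩, ⟨A, hpol, hconv
    (fun n => measurableSet_lt measurable_const (hZm n)) (hAm (measurableSet_singleton 1)) ?_⟩⟩
  · filter_upwards [hlim] with ω ⟨h1, h2, _⟩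
    rcases hA ω with h0 | h0
    · filter_upwards [h2 h0] with n hn using ⟨fun _ => h0, fun _ => hn⟩
    · rw [h0] at h1
      filter_upwards [h1.eventually_const_lt (show (1 / 2 : ℝ) < 1 by norm_num)] with n hn
      refine ⟨fun (hlt : Polar.ZHat μ X Y S B n ω < _) => ?_, fun (h3 : A ω = 0) => ?_⟩
      · linarith [hthr n]
      · rw [h0] at h3; exact absurd h3 one_ne_zero
  · filter_upwards [hlim] with ω ⟨h1, _, h2⟩
    rcases hA ω with h0 | h0
    · rw [h0] at h1
      filter_upwards [h1.eventually_lt_const (show (0 : ℝ) < 1 / 2 by norm_num)] with n hn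
      refine ⟨fun (hlt : Polar.ZHat μ X Y S B n ω > _) => ?_, fun (h3 : A ω = 1) => ?_⟩
      · linarith [hthr n]
      · rw [h0] at h3; exact absurd h3 zero_ne_one
    · filter_upwards [h2 h0] with n hn using ⟨fun _ => h0, fun _ => hn⟩
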